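/- **Conventions.** Let $\mathcal H$ be a separable complex Hilbert space, with inner product $\langle\cdot,\cdot\rangle$ linear in the first variable, and let $\mathcal L(\mathcal H)$ be the bounded operators on $\mathcal H$ with the operator norm. An operator $T\in\mathcal L(\mathcal H)$ is *positive semidefinite* if $\langle Tv,v\rangle\ge 0$ for all $v$, and *positive definite* if $\langle Tv,v\rangle>0$ for all $v\neq0$. A kernel $K:X\times X\to\mathcal L(\mathcal H)$ is *positive definite* if $\sum_{\mu,\nu=1}^n\langle K(x_\mu,x_\nu)v_\nu,v_\mu\rangle\ge0$ for all distinct points $x_1,\dots,x_n\in X$ and all $v_1,\dots,v_n\in\mathcal H$. It is *strictly positive definite* if moreover the sum vanishes only when all $v_\mu$ are zero. Its reproducing kernel Hilbert space $\mathcal H_K$ is the completion of the span of the functions $K(\cdot,x)v:X\to\mathcal H$ for the inner product with $\langle K(\cdot,x)v,K(\cdot,y)u\rangle_{\mathcal H_K}=\langle v,K(x,y)u\rangle$, realized as a space of functions $X\to\mathcal H$. For a Hausdorff space $Z$ and a Banach space $\mathfrak B$, a countably additive measure $\eta:\mathscr B(Z)\to\mathfrak B$ of bounded variation is *Radon* if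 its variation $|\eta|$ is outer regular on Borel sets and inner regular (by compact sets) on open sets. It *has a Radon–Nikodým decomposition* $d\eta=G\,d\lambda$ if $\lambda$ is a finite nonnegative measure on $\mathscr B(Z)$, $G:Z\to\mathfrak B$ is Bochner integrable with respect to $\lambda$, and $\eta(A)=\int_AG\,d\lambda$ for every Borel set $A$. Let $X$ be Hausdorff and let $K$ be a positive definite kernel on $X$ with $\mathcal H_K\subset C(X,\mathcal H)$. The kernel $K$ is *universal* if for every compact $A\subset X$, every continuous $g:A\to\mathcal H$ and every $\varepsilon>0$ there is $f\in\mathcal H_K$ with $\|f(x)-g(x)\|<\varepsilon$ for all $x\in A$. If $X$ is locally compact and $K$ is bounded, $K$ is *integrally strictly positive definite* if $$\int_X\Big\langle\int_XK(x,y)\,d\eta(x),\,d\eta(y)\Big\rangle>0$$ for every nonzero $\mathcal H$-valued Radon measure $\eta$ of bounded variation on $X$. Here $\int\langle F,d\eta\rangle$ is the integral that extends $\int\langle v\chi_A,d\eta\rangle=\langle v,\eta(A)\rangle$, and $\int K(x,y)\,d\eta(x)$ is the vector $u$ with $\langle v,u\rangle=\int\langle K(x,y)v,d\eta(x)\rangle$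 for all $v\in\mathcal H$. For complex valued kernels these notions are used with $\mathcal H=\mathbb C$. **Theorem.** Let $X$ be a nonempty Hausdorff space, let $\Omega$ be a locally compact Hausdorff space, and let $p:\Omega\times X\times X\to\mathbb C$ be a bounded continuous function such that $p_w:=p(w,\cdot,\cdot)$ is a positive definite kernel for every $w\in\Omega$. Let $\Lambda:\mathscr B(\Omega)\to\mathcal L(\mathcal H)$ be a Radon measure of bounded variation such that $\Lambda(A)$ is positive semidefinite for every Borel set $A$, and suppose that $\Lambda$ has a Radon–Nikodým decomposition. Put $$P(x,y)=\int_\Omega p_w(x,y)\,d\Lambda(w)\in\mathcal L(\mathcal H),\qquad P_v(x,y)=\langle P(x,y)v,v\rangle\quad(v\in\mathcal H\setminus\{0\}).$$ Then: 1. The integrals defining $P$ exist, $P$ is positive definite, and $P_v$ is positive definite for every $v\ne0$. 2. $P:X\times X\to\mathcal L(\mathcal H)$ is bounded and continuous for the operator norm, and $\mathcal H_P\subset C(X,\mathcal H)$. 3. If every $p_w$ is strictly positive definite, then the following are equivalent: $P$ is strictly positive definite; $P_v$ is strictly positive definite for every $v\neq0$; $\Lambda(\Omega)$ is a positive definite operator.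 4. If every $p_w$ is universal, then the following are equivalent: $P$ is universal; $P_v$ is universal for every $v\ne0$; $\Lambda(\Omega)$ is a positive definite operator. 5. If $X$ is locally compact and every $p_w$ is integrally strictly positive definite, then the following are equivalent: $P$ is integrally strictly positive definite; $P_v$ is integrally strictly positive definite for every $v\ne0$; $\Lambda(\Omega)$ is a positive definite operator. -/

import Mathlib

open MeasureTheory
open scoped ComplexOrder

noncomputable section

namespace OperatorKernel

section Kernels

variable {X H : Type*} [NormedAddCommGroup H] [InnerProductSpace ℂ H]

/-- A complex valued kernel, viewed as an operator valued kernel on the Hilbert space `ℂ` through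
the identification of `ℂ` with the bounded operators on `ℂ`. -/
def ofScalar (k : X → X → ℂ) (x y : X) : ℂ →L[ℂ] ℂ := k x y • ContinuousLinearMap.id ℂ ℂ

/-- The scalar valued projection `K_v(x, y) = ⟨K(x, y) v, v⟩` of an operator valued kernel.
(The inner product of Mathlib is linear in the second variable.) -/
def proj (K : X → X → H →L[ℂ] H) (v : H) (x y : X) : ℂ := inner ℂ v (K x y v)

/-- Positive definite operator valued kernels: `∑ ⟨K(x, y) v_y, v_x⟩ ≥ 0`, the sum being over
the pairs of elements of a finite set of points. The order on `ℂ` is the usual partial one,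
so `0 ≤ z` says that `z` is real and nonnegative. -/
def IsPosDef (K : X → X → H →L[ℂ] H) : Prop :=
  ∀ (s : Finset X) (v : X → H), 0 ≤ ∑ x ∈ s, ∑ y ∈ s, inner ℂ (v x) (K x y (v y))

/-- Strictly positive definite operator valued kernels. -/
def IsStrictlyPosDef (K : X → X → H →L[ℂ] H) : Prop :=
  IsPosDef K ∧ ∀ (s : Finset X) (v : X → H),
    ∑ x ∈ s, ∑ y ∈ s, inner ℂ (v x) (K x y (v y)) = 0 → ∀ x ∈ s, v x = 0

/-- Positive definite bounded operators: `⟨T v, v⟩ > 0` for every `v ≠ 0`. -/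
def IsPosDefOperator (T : H →L[ℂ] H) : Prop :=
  ∀ v : H, v ≠ 0 → 0 < inner ℂ v (T v)

variable [CompleteSpace H]

theorem IsPosDef.isHermitian {K : X → X → H →L[ℂ] H} (hK : IsPosDef K) :
    (Matrix.of K).IsHermitian := by
  classical
  have diag : ∀ x v, 0 ≤ inner ℂ v (K x x v) := fun x v => by
    simpa using hK {x} (fun _ => v)
  have key : ∀ x y v w, x ≠ y →
      (inner ℂ v (K x y w)).im + (inner ℂ w (K y x v)).im = 0 := by
    intro x y v w hxy
    have h := hK {x, y} (fun z => if z = x then v else w)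
    have h1 := (Complex.nonneg_iff.1 (diag x v)).2
    have h2 := (Complex.nonneg_iff.1 (diag y w)).2
    rw [Finset.sum_pair hxy, Finset.sum_pair hxy, Finset.sum_pair hxy] at h
    simp only [if_true, if_neg hxy.symm] at h
    have h3 := (Complex.nonneg_iff.1 h).2
    simp only [Complex.add_im] at h3
    linarith
  have adj : ∀ x y v w, inner ℂ v (K x y w) = inner ℂ (K y x v) w := by
    intro x y v w
    rw [← inner_conj_symm (K y x v) w]
    by_cases hxy : x = y
    · subst hxy
      have hs : (K x x : H →ₗ[ℂ] H).IsSymmetric := by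
        rw [LinearMap.isSymmetric_iff_inner_map_self_real]
        intro u
        have := (Complex.nonneg_iff.1 (diag x u)).2
        rw [inner_conj_symm]
        change inner ℂ u (K x x u) = inner ℂ (K x x u) u
        rw [← inner_conj_symm (K x x u) u]
        exact (Complex.conj_eq_iff_im.2 this.symm).symm
      rw [inner_conj_symm]
      exact (hs v w).symm
    · have a := key x y v w hxy
      have b := key x y (Complex.I • v) w hxy
      simp only [map_smul, inner_smul_left, inner_smul_right, Complex.conj_I, neg_mul,
        Complex.neg_im, Complex.I_mul_im] at b
      apply Complex.ext
      · rw [Complex.conj_re]; linarith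
      · rw [Complex.conj_im]; linarith
  ext x y w
  refine ext_inner_left ℂ fun v => ?_
  simp only [Matrix.conjTranspose_apply, Matrix.of_apply, ContinuousLinearMap.star_eq_adjoint,
    ContinuousLinearMap.adjoint_inner_right]
  exact (adj x y v w).symm

theorem IsPosDef.posSemidef {K : X → X → H →L[ℂ] H} (hK : IsPosDef K) :
    (Matrix.of K).PosSemidef := by
  have t := (RKHS.posSemidef_tfae (𝕜 := ℂ) (K := Matrix.of K)).out 0 2
  refine t.2 ⟨hK.isHermitian, fun f => ?_⟩
  have h := (Complex.nonneg_iff.1 (hK f.support f)).1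
  have e : (f.sum fun x w => f.sum fun x' w' => inner ℂ (Matrix.of K x' x w) w') =
      star (∑ x ∈ f.support, ∑ y ∈ f.support, inner ℂ (f x) (K x y (f y))) := by
    simp only [Finsupp.sum, star_sum, Matrix.of_apply]
    rw [Finset.sum_comm]
    exact Finset.sum_congr rfl fun x _ => Finset.sum_congr rfl fun y _ =>
      (inner_conj_symm _ _).symm
  rw [e]
  exact h

/-- The reproducing kernel Hilbert space of an operator valued positive definite kernel, as a set
of functions: the completion of the span of the functions `K_x v = K(·, x) v`. -/
def rkhs (K : X → X → H →L[ℂ] H) : Set (X → H) :=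
  {f | ∃ hK : IsPosDef K,
    haveI : Fact (Matrix.of K).PosSemidef := ⟨hK.posSemidef⟩
    ∃ F : RKHS.OfKernel (Matrix.of K), f = ⇑F}

/-- Universal kernels. -/
structure IsUniversal [TopologicalSpace X] (K : X → X → H →L[ℂ] H) : Prop where
  posDef : IsPosDef K
  continuous : ∀ f ∈ rkhs K, Continuous f
  dense : ∀ (A : Set X), IsCompact A → ∀ (g : C(A, H)) (ε : ℝ), 0 < ε →
    ∃ f ∈ rkhs K, ∀ x : A, ‖f x - g x‖ < ε

end Kernels

section Measures

variable {X E : Type*} [TopologicalSpace X] [MeasurableSpace X] [NormedAddCommGroup E]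

/-- Vector valued Radon measures of bounded variation: the variation is finite, outer regular on
Borel sets and inner regular on open sets with respect to compact sets. -/
structure IsRadonBV (η : VectorMeasure X E) : Prop where
  finite : IsFiniteMeasure η.variation
  regular : η.variation.Regular

/-- The measure `Λ` has a density with respect to a finite nonnegative measure: `dΛ = G dλ` with
`G` Bochner integrable. -/
def HasRadonNikodym [NormedSpace ℝ E] (Λ : VectorMeasure X E) : Prop :=
  ∃ (lam : Measure X) (G : X → E), IsFiniteMeasure lam ∧ Integrable G lam ∧
    ∀ A, MeasurableSet A → Λ A = ∫ w in A, G w ∂lam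

end Measures

section Integrals

variable {X H : Type*} [MeasurableSpace X] [NormedAddCommGroup H] [InnerProductSpace ℂ H]

/-- The inner product `(u, v) ↦ ⟨u, v⟩`, linear in `u` and antilinear in `v`, as a continuous
real bilinear map. -/
def pairing (H : Type*) [NormedAddCommGroup H] [InnerProductSpace ℂ H] : H →L[ℝ] H →L[ℝ] ℂ :=
  LinearMap.mkContinuous₂
    (LinearMap.mk₂ ℝ (fun u v : H => (inner ℂ v u : ℂ))
      (fun _ _ _ => inner_add_right _ _ _)
      (fun _ _ _ => inner_smul_right_eq_smul _ _ _)
      (fun _ _ _ => inner_add_left _ _ _)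
      (fun c u v => by rw [← Complex.coe_smul, inner_smul_left]; simp))
    1 (fun u v => by simpa [mul_comm] using norm_inner_le_norm (𝕜 := ℂ) v u)

@[simp]
theorem pairing_apply (u v : H) : pairing H u v = inner ℂ v u := rfl

/-- The integral `∫ ⟨F(x), dη(x)⟩` of a Hilbert valued function with respect to a Hilbert valued
measure. -/
def bartle (η : VectorMeasure X H) (F : X → H) : ℂ := η.integral F (pairing H)

/-- `u` is the weak integral `∫ T(x) dη(x)`, that is,
`⟨v, u⟩ = ∫ ⟨T(x) v, dη(x)⟩` for every `v`. -/
def IsWeakIntegral (η : VectorMeasure X H) (T : X → H →L[ℂ] H) (u : H) : Prop :=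
  ∀ v : H, η.Integrable (fun x => T x v) ∧ inner ℂ u v = bartle η (fun x => T x v)

open scoped Classical in
/-- The weak integral `∫ T(x) dη(x)` of an operator valued function with respect to a Hilbert
valued measure (zero if it does not exist). -/
def weakIntegral (η : VectorMeasure X H) (T : X → H →L[ℂ] H) : H :=
  if h : ∃ u, IsWeakIntegral η T u then h.choose else 0

/-- Integrally strictly positive definite kernels. The condition is
`∫ ⟨∫ K(x, y) dη(x), dη(y)⟩ > 0` for every nonzero Radon measure `η` of bounded variation. -/
structure IsIntegrallyStrictlyPosDef [CompleteSpace H] [TopologicalSpace X]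
    (K : X → X → H →L[ℂ] H) : Prop where
  posDef : IsPosDef K
  bounded : ∃ C : ℝ, ∀ x y, ‖K x y‖ ≤ C
  continuous : ∀ f ∈ rkhs K, Continuous f
  pos : ∀ η : VectorMeasure X H, IsRadonBV η → η ≠ 0 →
    0 < bartle η (fun y => weakIntegral η (fun x => K x y))

/-- The operator valued kernel `P(x, y) = ∫ p_w(x, y) dΛ(w)`, the integral of a complex valued
function with respect to an operator valued measure. -/
def mixture {Ω : Type*} [MeasurableSpace Ω] {Y : Type*} (p : Ω → Y → Y → ℂ)
    (Λ : VectorMeasure Ω (H →L[ℂ] H)) (x y : Y) : H →L[ℂ] H :=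
  Λ.integral (fun w => p w x y) (ContinuousLinearMap.lsmul ℝ ℂ)

end Integrals

end OperatorKernel

end

noncomputable section

namespace OperatorKernel

open Filter Topology BoundedContinuousFunction Set

/-! The measure is disintegrated as `dΛ = G dμ`. Testing positivity of `Λ A` on a countable dense
set of vectors makes `G w` a positive operator for almost every `w`, so `P(x, y) = ∫ p_w(x, y) G(w)
dμ(w)` is an average of the kernels `p_w G(w)`. Each of these is positive definite by a Schur
product argument (`sum_smul_eq`): factor `G(w)` as `S* S` and expand in a finite orthonormal basis.

Each equivalence is a cycle. From `P` to `P_v`, one tests on vectors proportional to `v`. From `P_v`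
to the operator, `⟨Λ(Ω)v, v⟩ = 0` would force `⟨G(w)v, v⟩ = 0` almost everywhere, hence `P_v = 0`,
which none of the three properties allows on a nonempty space. The return to `P` is the substantial
step.

For strict positivity, a vanishing quadratic form vanishes for almost every component, giving
`⟨G(w)v_x, v_x⟩ = 0`; integration yields `⟨Λ(Ω)v_x, v_x⟩ = 0`. The other two properties are dual
statements: a functional `L`, on `C(A, H)` or given by a measure, that kills all sections `P(·, y)v`
must vanish. Let `f_w` represent `L` in the reproducing kernel space of `p_w G(w)`. Then `∫ f_w dμ =
0` pointwise, while `∫ L(f_w) dμ = ∫ ‖f_w‖² dμ`, the norm being that of the space. Exchanging `L`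
with the integral (`IsTight.integral_eq`) gives `f_w = 0` for almost every `w`
(`ae_vanish_of_vanish`). The scalar hypothesis on `p_w` removes the kernel, leaving a relation
`⟨G(w)z, z⟩ = 0` for a suitable vector `z`, and positivity of `Λ(Ω)` gives `z = 0`.

The exchange is delicate because `w ↦ f_w` need not be strongly measurable for the uniform norm on
`X`. Tight functionals reduce it to compact subsets of `X`, and regularity of `|Λ|` confines `μ` to
a σ-compact set, on which continuous maps to metric spaces have separable range. -/

theorem integrable_of_bounded {X E : Type*} [MeasurableSpace X] [NormedAddCommGroup E]
    {μ : Measure X} [IsFiniteMeasure μ] {f : X → E}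
    (hf : StronglyMeasurable f) (hb : ∃ C, ∀ x, ‖f x‖ ≤ C) : Integrable f μ :=
  let ⟨_, hC⟩ := hb
  Integrable.of_bound hf.aestronglyMeasurable _ (Eventually.of_forall hC)

/-! ### Uniqueness of integrals with bounded convergence -/

section BoundedIntegrals

variable {X E F : Type*} [MeasurableSpace X] [NormedAddCommGroup E] [NormedSpace ℝ E]
  [NormedAddCommGroup F]

/-- Functionals on functions that are additive and satisfy the bounded convergence theorem on
bounded strongly measurable functions. -/
structure IsBoundedIntegral (I : (X → E) → F) : Prop where
  add : ∀ f g : X → E, StronglyMeasurable f → StronglyMeasurable g →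
    (∃ C, ∀ x, ‖f x‖ ≤ C) → (∃ C, ∀ x, ‖g x‖ ≤ C) → I (f + g) = I f + I g
  tendsto : ∀ (f : ℕ → X → E) (g : X → E) (C : ℝ), (∀ n, StronglyMeasurable (f n)) →
    (∀ n x, ‖f n x‖ ≤ C) → (∀ x, Tendsto (fun n => f n x) atTop (𝓝 (g x))) →
    Tendsto (fun n => I (f n)) atTop (𝓝 (I g))

/-- Additivity extends agreement from indicators to simple functions, and uniformly bounded simple
approximation extends it to the limit. Integral formulas thereby reduce to values on sets. -/
theorem IsBoundedIntegral.eq_of_indicator {I J : (X → E) → F} (hI : IsBoundedIntegral I)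
    (hJ : IsBoundedIntegral J)
    (h : ∀ s, MeasurableSet s → ∀ c : E, I (s.indicator fun _ => c) = J (s.indicator fun _ => c))
    {f : X → E} (hf : StronglyMeasurable f) {C : ℝ} (hC : ∀ x, ‖f x‖ ≤ C) : I f = J f := by
  have hs : ∀ g : SimpleFunc X E, I g = J g := by
    intro g
    induction g using SimpleFunc.induction with
    | const c hs =>
      classical
      rw [SimpleFunc.coe_piecewise, SimpleFunc.coe_const, SimpleFunc.coe_const,
        Function.const_zero, Set.piecewise_eq_indicator]
      exact h _ hs c
    | @add f g _ hf hg =>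
      rw [SimpleFunc.coe_add,
        hI.add _ _ f.stronglyMeasurable g.stronglyMeasurable f.exists_forall_norm_le
          g.exists_forall_norm_le,
        hJ.add _ _ f.stronglyMeasurable g.stronglyMeasurable f.exists_forall_norm_le
          g.exists_forall_norm_le, hf, hg]
  -- A point of `X` is needed to know that the bound `C` is nonnegative.
  rcases isEmpty_or_nonempty X with hX | ⟨⟨x⟩⟩
  · have := h ∅ MeasurableSet.empty 0
    rwa [Subsingleton.elim f (Set.indicator ∅ fun _ => (0 : E))]
  have h0 : 0 ≤ C := (norm_nonneg _).trans (hC x)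
  have key : ∀ I : (X → E) → F, IsBoundedIntegral I →
      Tendsto (fun n => I (hf.approxBounded C n)) atTop (𝓝 (I f)) := fun I hI =>
    hI.tendsto _ _ C (fun n => (hf.approxBounded C n).stronglyMeasurable)
      (fun n x => hf.norm_approxBounded_le h0 n x)
      (fun x => hf.tendsto_approxBounded_of_norm_le (hC x))
  refine tendsto_nhds_unique (key I hI) ?_
  simpa only [hs] using key J hJ

end BoundedIntegrals

/-! ### Integrals against vector measures: densities and images -/

section VectorMeasures

variable {X E E' F G : Type*} [MeasurableSpace X]
  [NormedAddCommGroup E] [NormedSpace ℝ E] [NormedAddCommGroup E'] [NormedSpace ℝ E']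
  [NormedAddCommGroup F] [NormedSpace ℝ F] [NormedAddCommGroup G] [NormedSpace ℝ G]

theorem isBoundedIntegral_integral_comp (η : VectorMeasure X F) [IsFiniteMeasure η.variation]
    (B : E →L[ℝ] F →L[ℝ] G) (g : E' →L[ℝ] E) :
    IsBoundedIntegral fun f : X → E' => η.integral (fun x => g (f x)) B where
  add f f' hf hf' hC hC' := by
    have aux : ∀ f : X → E', StronglyMeasurable f → (∃ C, ∀ x, ‖f x‖ ≤ C) →
        η.Integrable fun x => g (f x) := fun f hf hC =>
      g.integrable_comp (integrable_of_bounded hf hC)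
    simp only [Pi.add_apply, map_add]
    exact VectorMeasure.integral_fun_add (aux f hf hC) (aux f' hf' hC')
  tendsto f f' C hf hC hl := by
    refine VectorMeasure.tendsto_integral_filter_of_norm_le_const
      (.of_forall fun n => (g.continuous.comp_stronglyMeasurable (hf n)).aestronglyMeasurable)
      ⟨‖g‖ * C, .of_forall fun n => .of_forall fun x => ?_⟩
      (.of_forall fun x => (g.continuous.tendsto _).comp (hl x))
    exact (g.le_opNorm _).trans (mul_le_mul_of_nonneg_left (hC n x) (norm_nonneg _))

theorem isBoundedIntegral_integral (η : VectorMeasure X F) [IsFiniteMeasure η.variation]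
    (B : E →L[ℝ] F →L[ℝ] G) : IsBoundedIntegral fun f : X → E => η.integral f B :=
  isBoundedIntegral_integral_comp η B (ContinuousLinearMap.id ℝ E)

theorem isBoundedIntegral_density {μ : Measure X} {D : X → F} (hD : Integrable D μ)
    (B : E →L[ℝ] F →L[ℝ] G) : IsBoundedIntegral fun f : X → E => ∫ x, B (f x) (D x) ∂μ where
  add f f' hf hf' hC hC' := by
    have aux : ∀ f : X → E, StronglyMeasurable f → (∃ C, ∀ x, ‖f x‖ ≤ C) →
        Integrable (fun x => B (f x) (D x)) μ := by
      rintro f hf ⟨C, hC⟩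
      refine (hD.norm.const_mul (‖B‖ * C)).mono'
        (B.aestronglyMeasurable_comp₂ hf.aestronglyMeasurable hD.1) (.of_forall fun x => ?_)
      grw [B.le_opNorm₂, hC x]
    simp only [Pi.add_apply, map_add, _root_.add_apply]
    exact integral_add (aux f hf hC) (aux f' hf' hC')
  tendsto f f' C hf hC hl := by
    refine tendsto_integral_of_dominated_convergence (fun x => ‖B‖ * C * ‖D x‖)
      (fun n => B.aestronglyMeasurable_comp₂ (hf n).aestronglyMeasurable hD.1)
      (hD.norm.const_mul _) (fun n => .of_forall fun x => ?_) (.of_forall fun x => ?_)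
    · grw [B.le_opNorm₂, hC n x]
    · exact ((B.flip (D x)).continuous.tendsto _).comp (hl x)

theorem vectorIntegral_indicator_const [CompleteSpace G] (η : VectorMeasure X F)
    [IsFiniteMeasure η.variation] (B : E →L[ℝ] F →L[ℝ] G) {s : Set X} (hs : MeasurableSet s)
    (c : E) : η.integral (s.indicator fun _ => c) B = B c (η s) := by
  rw [VectorMeasure.integral_eq_setToFun,
    setToFun_indicator_const _ hs (measure_ne_top _ _), transpose_eq_cbmApplyMeasure,
    cbmApplyMeasure_apply]

theorem integral_eq_integral_density [CompleteSpace F] [CompleteSpace G] (η : VectorMeasure X F)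
    [IsFiniteMeasure η.variation] {μ : Measure X} {D : X → F}
    (hD : Integrable D μ) (hη : ∀ A, MeasurableSet A → η A = ∫ x in A, D x ∂μ)
    (B : E →L[ℝ] F →L[ℝ] G) {f : X → E} (hf : StronglyMeasurable f) {C : ℝ}
    (hC : ∀ x, ‖f x‖ ≤ C) : η.integral f B = ∫ x, B (f x) (D x) ∂μ := by
  refine (isBoundedIntegral_integral η B).eq_of_indicator (isBoundedIntegral_density hD B)
    (fun s hs c => ?_) hf hC
  rw [vectorIntegral_indicator_const η B hs, hη s hs, ← (B c).integral_comp_comm hD.integrableOn,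
    ← integral_indicator hs]
  congr 1
  ext x
  by_cases hx : x ∈ s <;> simp [hx]

theorem integral_mapRange {F' : Type*} [NormedAddCommGroup F'] [NormedSpace ℝ F']
    [CompleteSpace G] (η : VectorMeasure X F) [IsFiniteMeasure η.variation]
    (φ : F →L[ℝ] F') [IsFiniteMeasure (η.mapRange (φ : F →+ F') φ.continuous).variation]
    (B : E →L[ℝ] F →L[ℝ] G) (B' : E' →L[ℝ] F' →L[ℝ] G) (g : E' →L[ℝ] E)
    (h : ∀ e y, B' e (φ y) = B (g e) y)
    {f : X → E'} (hf : StronglyMeasurable f) {C : ℝ} (hC : ∀ x, ‖f x‖ ≤ C) :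
    (η.mapRange (φ : F →+ F') φ.continuous).integral f B' =
      η.integral (fun x => g (f x)) B := by
  refine (isBoundedIntegral_integral _ B').eq_of_indicator
    (isBoundedIntegral_integral_comp η B g) (fun s hs c => ?_) hf hC
  have : (fun x => g (s.indicator (fun _ => c) x)) = s.indicator fun _ => g c := by
    ext x; by_cases hx : x ∈ s <;> simp [hx]
  rw [vectorIntegral_indicator_const _ B' hs, this, vectorIntegral_indicator_const η B hs]
  exact h _ _

end VectorMeasures

/-- Joint continuity only controls the compact-open topology. This is the uniform topology once `A`
is compact, but would not suffice on all of `X`. -/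
theorem continuous_restrict_of_continuous {X Y E : Type*} [TopologicalSpace X]
    [NormedAddCommGroup E] [TopologicalSpace Y] (A : Set X)
    {φ : Y → X →ᵇ E} (hφ : Continuous fun q : Y × X => φ q.1 q.2) :
    Continuous fun y => (φ y).toContinuousMap.restrict A :=
  ContinuousMap.continuous_of_continuous_uncurry _
    (hφ.comp (continuous_id.prodMap continuous_subtype_val))

theorem stronglyMeasurable_bcf {X E : Type*} [TopologicalSpace X] [MeasurableSpace X]
    [BorelSpace X] [NormedAddCommGroup E] [TopologicalSpace.SeparableSpace E] (f : X →ᵇ E) :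
    StronglyMeasurable f := by
  have : SecondCountableTopology E := UniformSpace.secondCountable_of_separable E
  exact f.continuous.stronglyMeasurable

theorem integral_complex_smul {X E F G : Type*} [MeasurableSpace X] [NormedAddCommGroup E]
    [NormedSpace ℂ E] [NormedAddCommGroup F] [NormedSpace ℂ F] [NormedAddCommGroup G]
    [NormedSpace ℂ G] (η : VectorMeasure X G) (B : E →L[ℝ] G →L[ℝ] F)
    (hB : ∀ (c : ℂ) x y, B (c • x) y = c • B x y) (c : ℂ) (f : X → E) :
    η.integral (fun x => c • f x) B = c • η.integral f B :=
  setToFun_smul (𝕜 := ℂ) _ (fun c s x => hB c x (η s)) c f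

/-! ### Tight operators on bounded continuous functions -/

section Functionals

variable {X E F G : Type*} [TopologicalSpace X] [NormedAddCommGroup E]
  [NormedSpace ℂ E] [NormedAddCommGroup F] [NormedSpace ℂ F] [NormedAddCommGroup G]
  [NormedSpace ℂ G]

/-- Bounded operators on bounded continuous functions that are approximated in norm by operators
that factor through the restriction to a compact set. -/
def IsTight (T : (X →ᵇ E) →L[ℂ] F) : Prop :=
  ∀ ε : ℝ, 0 < ε → ∃ A : Set X, IsCompact A ∧ ∃ S : C(A, E) →L[ℂ] F,
    ∀ f : X →ᵇ E, ‖T f - S (f.toContinuousMap.restrict A)‖ ≤ ε * ‖f‖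

/-- A uniform limit argument: the operators that see only a compact set turn joint continuity into
norm continuity, and the error is uniform because the family is bounded. -/
theorem IsTight.continuous {Y : Type*} [TopologicalSpace Y] {T : (X →ᵇ E) →L[ℂ] F}
    (hT : IsTight T) {φ : Y → X →ᵇ E} {C : ℝ} (hC : ∀ y, ‖φ y‖ ≤ C)
    (hφ : Continuous fun q : Y × X => φ q.1 q.2) : Continuous fun y => T (φ y) := by
  refine continuous_of_uniform_approx_of_continuous fun u hu => ?_
  obtain ⟨ε, hε, hu⟩ := Metric.mem_uniformity_dist.1 hu
  rcases isEmpty_or_nonempty Y with hY | ⟨⟨y₀⟩⟩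
  · exact ⟨fun _ => 0, continuous_const, fun y => hY.elim y⟩
  have h0 : 0 ≤ C := (norm_nonneg _).trans (hC y₀)
  obtain ⟨A, -, S, hS⟩ := hT (ε / (C + 1)) (by positivity)
  refine ⟨fun y => S ((φ y).toContinuousMap.restrict A),
    S.continuous.comp (continuous_restrict_of_continuous A hφ), fun y => hu ?_⟩
  rw [dist_eq_norm]
  calc _ ≤ ε / (C + 1) * ‖φ y‖ := hS _
    _ ≤ ε / (C + 1) * C := by gcongr; exact hC y
    _ < ε / (C + 1) * (C + 1) := by gcongr; linarith
    _ = ε := by field_simp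

theorem isTight_comp_restrict {A : Set X} (hA : IsCompact A) (S : C(A, E) →L[ℂ] F)
    {T : (X →ᵇ E) →L[ℂ] F} (hT : ∀ f : X →ᵇ E, T f = S (f.toContinuousMap.restrict A)) :
    IsTight T := fun ε hε =>
  ⟨A, hA, S, fun f => by rw [hT, sub_self, norm_zero]; positivity⟩

/-- Restriction of bounded continuous functions to a compact set. -/
def restrictCLM (A : Set X) [CompactSpace A] : (X →ᵇ E) →L[ℂ] C(A, E) :=
  LinearMap.mkContinuous
    { toFun := fun f => f.toContinuousMap.restrict A
      map_add' := fun _ _ => rfl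
      map_smul' := fun _ _ => rfl } 1 fun f => by
    rw [one_mul, ContinuousMap.norm_le _ (norm_nonneg _)]
    exact fun x => f.norm_coe_le_norm x

@[simp]
theorem restrictCLM_apply (A : Set X) [CompactSpace A] (f : X →ᵇ E) :
    restrictCLM A f = f.toContinuousMap.restrict A := rfl

/-- The bounded continuous function `x ↦ f x • u`, bilinear in `f` and `u`. -/
def tensorCLM (Y : Type*) [TopologicalSpace Y] : (Y →ᵇ ℂ) →L[ℂ] E →L[ℂ] (Y →ᵇ E) :=
  LinearMap.mkContinuous₂
    (LinearMap.mk₂ ℂ (fun (f : Y →ᵇ ℂ) (u : E) =>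
        (ContinuousLinearMap.toSpanSingleton ℂ u).compLeftContinuousBounded Y f)
      (fun _ _ _ => by ext; simp) (fun _ _ _ => by ext; simp)
      (fun _ _ _ => by ext; simp) (fun c f u => by ext; simp [smul_comm c]))
    1 fun f u => by
      rw [one_mul, BoundedContinuousFunction.norm_le (by positivity)]
      intro x
      simp only [LinearMap.mk₂_apply, ContinuousLinearMap.compLeftContinuousBounded_apply,
        ContinuousLinearMap.toSpanSingleton_apply, norm_smul]
      gcongr
      exact f.norm_coe_le_norm x

@[simp]
theorem tensorCLM_apply (f : X →ᵇ ℂ) (u : E) (x : X) : tensorCLM X f u x = f x • u := rfl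

/-- The tensor product of a continuous function on a compact space and a vector. -/
def tensorC (Y : Type*) [TopologicalSpace Y] [CompactSpace Y] :
    C(Y, ℂ) →L[ℂ] E →L[ℂ] C(Y, E) :=
  LinearMap.mkContinuous₂
    (LinearMap.mk₂ ℂ (fun (f : C(Y, ℂ)) (u : E) =>
        (ContinuousLinearMap.toSpanSingleton ℂ u).compLeftContinuous ℂ Y f)
      (fun _ _ _ => by ext; simp [add_smul]) (fun _ _ _ => by ext; simp)
      (fun _ _ _ => by ext; simp) (fun c f u => by ext; simp [smul_comm c]))
    1 fun f u => by
      rw [one_mul, ContinuousMap.norm_le _ (by positivity)]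
      intro x
      change ‖f x • u‖ ≤ _
      rw [norm_smul]
      gcongr
      exact f.norm_coe_le_norm x

/-- The operator `f ↦ (u ↦ L (f u))` on scalar functions. -/
def slice (L : (X →ᵇ E) →L[ℂ] F) : (X →ᵇ ℂ) →L[ℂ] E →L[ℂ] F :=
  (ContinuousLinearMap.compL ℂ E (X →ᵇ E) F L).comp (tensorCLM X)

/-- Since `‖f ⊗ u‖ ≤ ‖f‖ ‖u‖`, slicing the compact approximant of `L` approximates the slice with
the same `ε`, in operator norm. -/
theorem IsTight.slice {L : (X →ᵇ E) →L[ℂ] F} (hL : IsTight L) : IsTight (slice L) := by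
  intro ε hε
  obtain ⟨A, hA, S, hS⟩ := hL ε hε
  have := isCompact_iff_compactSpace.1 hA
  refine ⟨A, hA, (ContinuousLinearMap.compL ℂ E C(A, E) F S).comp (tensorC A), fun f => ?_⟩
  refine ContinuousLinearMap.opNorm_le_bound _ (by positivity) fun u => ?_
  have e : tensorC A (f.toContinuousMap.restrict A) u =
      (tensorCLM X f u).toContinuousMap.restrict A := rfl
  have h := hS (tensorCLM X f u)
  rw [← e] at h
  refine h.trans ?_
  rw [mul_assoc]
  gcongr
  rw [BoundedContinuousFunction.norm_le (by positivity)]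
  intro x
  rw [tensorCLM_apply, norm_smul]
  gcongr
  exact f.norm_coe_le_norm x

variable [MeasurableSpace X] [BorelSpace X]

/-- The integral with respect to a vector measure, as an operator on bounded continuous
functions. -/
def integralCLM [TopologicalSpace.SeparableSpace E] (η : VectorMeasure X G)
    [IsFiniteMeasure η.variation] (B : E →L[ℝ] G →L[ℝ] F)
    (hB : ∀ (c : ℂ) x y, B (c • x) y = c • B x y) : (X →ᵇ E) →L[ℂ] F :=
  LinearMap.mkContinuous
    { toFun := fun f => η.integral f B
      map_add' := fun f g => (isBoundedIntegral_integral η B).add f g (stronglyMeasurable_bcf f)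
        (stronglyMeasurable_bcf g) ⟨_, f.norm_coe_le_norm⟩ ⟨_, g.norm_coe_le_norm⟩
      map_smul' := fun c f => integral_complex_smul η B hB c f }
    (‖B‖ * η.variation.real univ) fun f => by
      have := VectorMeasure.norm_integral_le_of_norm_le_const (B := B)
        (Eventually.of_forall f.norm_coe_le_norm : ∀ᵐ x ∂η.variation, _)
      refine this.trans (le_of_eq ?_)
      ring

@[simp]
theorem integralCLM_apply [TopologicalSpace.SeparableSpace E] (η : VectorMeasure X G)
    [IsFiniteMeasure η.variation] (B : E →L[ℝ] G →L[ℝ] F)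
    (hB : ∀ (c : ℂ) x y, B (c • x) y = c • B x y) (f : X →ᵇ E) :
    integralCLM η B hB f = η.integral f B := rfl

/-- Inner regularity leaves little variation outside some compact set, so integrating over that set
alone costs at most a small multiple of `‖f‖`. -/
theorem isTight_integralCLM [T2Space X] [TopologicalSpace.SeparableSpace E]
    (η : VectorMeasure X G) [IsFiniteMeasure η.variation] [η.variation.Regular]
    (B : E →L[ℝ] G →L[ℝ] F) (hB : ∀ (c : ℂ) x y, B (c • x) y = c • B x y) :
    IsTight (integralCLM η B hB) := by
  intro ε hε
  obtain ⟨A, -, hA, hlt⟩ := MeasurableSet.univ.exists_isCompact_sdiff_lt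
    (measure_ne_top η.variation univ)
    (ε := ENNReal.ofReal (ε / (‖B‖ + 1))) (by simpa using by positivity)
  have := isCompact_iff_compactSpace.1 hA
  have : SecondCountableTopology E := UniformSpace.secondCountable_of_separable E
  have hAm := hA.measurableSet
  -- Extension by zero loses continuity but stays measurable, which is all that the integral
  -- requires; no Tietze extension is used.
  let ex : C(A, E) → X → E := fun f => Function.extend Subtype.val f 0
  have ex_mem : ∀ f x (hx : x ∈ A), ex f x = f ⟨x, hx⟩ := fun f x hx =>
    Subtype.val_injective.extend_apply f 0 ⟨x, hx⟩
  have ex_notMem : ∀ f x, x ∉ A → ex f x = 0 := fun f x hx =>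
    Function.extend_apply' _ _ _ (by rintro ⟨y, rfl⟩; exact hx y.2)
  have ex_meas : ∀ f, StronglyMeasurable (ex f) := fun f =>
    (MeasurableEmbedding.subtype_coe hAm).stronglyMeasurable_extend
      f.continuous.stronglyMeasurable stronglyMeasurable_zero
  have ex_norm : ∀ f x, ‖ex f x‖ ≤ ‖f‖ := fun f x => by
    by_cases hx : x ∈ A
    · rw [ex_mem f x hx]; exact f.norm_coe_le_norm _
    · rw [ex_notMem f x hx]; simp
  let S : C(A, E) →L[ℂ] F := LinearMap.mkContinuous
    { toFun := fun f => η.integral (ex f) B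
      map_add' := fun f g => by
        rw [← (isBoundedIntegral_integral η B).add _ _ (ex_meas f) (ex_meas g)
          ⟨_, ex_norm f⟩ ⟨_, ex_norm g⟩]
        congr 1
        ext x
        by_cases hx : x ∈ A
        · simp [ex_mem _ x hx]
        · simp [ex_notMem _ x hx]
      map_smul' := fun c f => by
        rw [RingHom.id_apply, ← integral_complex_smul η B hB c]
        congr 1
        ext x
        by_cases hx : x ∈ A
        · simp [ex_mem _ x hx]
        · simp [ex_notMem _ x hx] }
    (‖B‖ * η.variation.real univ) fun f => by
      have := VectorMeasure.norm_integral_le_of_norm_le_const (B := B)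
        (Eventually.of_forall (ex_norm f) : ∀ᵐ x ∂η.variation, _)
      refine this.trans (le_of_eq ?_)
      ring
  refine ⟨A, hA, S, fun f => ?_⟩
  have hSf : S (f.toContinuousMap.restrict A) =
    η.integral (ex (f.toContinuousMap.restrict A)) B := rfl
  rw [hSf, integralCLM_apply, ← VectorMeasure.integral_sub
    (integrable_of_bounded (stronglyMeasurable_bcf f) ⟨_, f.norm_coe_le_norm⟩)
    (integrable_of_bounded (ex_meas _) ⟨_, ex_norm _⟩)]
  refine VectorMeasure.norm_integral_le_integral_norm.trans ?_
  have h1 : ∫ x, ‖(f - ex (f.toContinuousMap.restrict A)) x‖ ∂η.variation ≤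
      ‖f‖ * η.variation.real Aᶜ := by
    have : ∀ x, ‖((f : X → E) - ex (f.toContinuousMap.restrict A)) x‖ ≤
        Aᶜ.indicator (fun _ => ‖f‖) x := fun x => by
      by_cases hx : x ∈ A
      · simp [ex_mem _ x hx, hx]
      · simpa [ex_notMem _ x hx, hx] using f.norm_coe_le_norm x
    refine (integral_mono_of_nonneg (.of_forall fun _ => norm_nonneg _)
      ((integrable_const _).indicator hAm.compl) (.of_forall this)).trans ?_
    rw [MeasureTheory.integral_indicator_const _ hAm.compl, smul_eq_mul, mul_comm]
  have h2 : η.variation.real Aᶜ ≤ ε / (‖B‖ + 1) := by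
    rw [measureReal_def]
    refine ENNReal.toReal_le_of_le_ofReal (by positivity) ?_
    rw [compl_eq_univ_sdiff]
    exact hlt.le
  calc _ ≤ ‖B‖ * (‖f‖ * (ε / (‖B‖ + 1))) := by gcongr; exact h1.trans (by gcongr)
    _ = ε * ‖f‖ * (‖B‖ / (‖B‖ + 1)) := by ring
    _ ≤ ε * ‖f‖ * 1 := by gcongr; rw [div_le_one (by positivity)]; linarith
    _ = ε * ‖f‖ := mul_one _

end Functionals

/-! ### Continuity and Riesz representers in reproducing kernel spaces -/

section ReproducingKernels

variable {X H : Type*} [NormedAddCommGroup H] [InnerProductSpace ℂ H] [CompleteSpace H]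

section OfKernel

variable {K : Matrix X X (H →L[ℂ] H)} [Fact K.PosSemidef]

theorem norm_kerFun_le {C : ℝ} (hC : ∀ x, ‖K x x‖ ≤ C) (x : X) :
    ‖RKHS.kerFun (RKHS.OfKernel K) x‖ ≤ √C := by
  rw [RKHS.norm_kerFun_eq_sqrt_norm_kernel, RKHS.OfKernel.kernel_ofKernel]
  exact Real.sqrt_le_sqrt (hC x)

theorem kerFun_ofKernel_apply (x y : X) (v : H) :
    RKHS.kerFun (RKHS.OfKernel K) y v x = K x y v := by
  rw [RKHS.kerFun_apply, RKHS.OfKernel.kernel_ofKernel]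

theorem norm_ofKernel_apply_le {C : ℝ} (hC : ∀ x, ‖K x x‖ ≤ C) (F : RKHS.OfKernel K) (x : X) :
    ‖F x‖ ≤ √C * ‖F‖ := by
  refine (RKHS.norm_apply_le F x).trans ?_
  rw [RKHS.OfKernel.kernel_ofKernel, mul_comm]
  gcongr
  exact hC x

/-- A bounded diagonal makes norm convergence uniform, so the continuous members form a closed
subspace; it contains the kernel sections, whose span is dense. -/
theorem continuous_ofKernel [TopologicalSpace X] {C : ℝ} (hC : ∀ x, ‖K x x‖ ≤ C)
    (hc : ∀ y v, Continuous fun x => K x y v) (F : RKHS.OfKernel K) : Continuous ⇑F := by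
  let S : Submodule ℂ (RKHS.OfKernel K) :=
    { carrier := {F | Continuous ⇑F}
      add_mem' := fun {f g} hf hg => by
        simp only [mem_ofPred_eq, RKHS.coe_add] at hf hg ⊢
        exact hf.add hg
      zero_mem' := by
        simp only [mem_ofPred_eq, RKHS.coe_zero]
        exact continuous_const
      smul_mem' := fun c f hf => by
        simp only [mem_ofPred_eq, RKHS.coe_smul] at hf ⊢
        exact continuous_const.smul hf }
  have hS : IsClosed (S : Set (RKHS.OfKernel K)) := by
    refine IsSeqClosed.isClosed fun f g hf hg => ?_
    exact (RKHS.tendstoUniformly_of_norm_kerFun_le (norm_kerFun_le hC) hg).continuous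
      (Frequently.of_forall hf)
  have hle : (Submodule.span ℂ {RKHS.kerFun (RKHS.OfKernel K) x v | (x) (v)}) ≤ S := by
    refine Submodule.span_le.2 ?_
    rintro _ ⟨y, v, rfl⟩
    refine (hc y v).congr fun x => ?_
    rw [kerFun_ofKernel_apply]
  have htop := Submodule.topologicalClosure_minimal _ hle hS
  rw [RKHS.kerFun_dense] at htop
  exact htop (Submodule.mem_top (x := F))

/-- The inclusion of a reproducing kernel Hilbert space into the bounded continuous functions. -/
def ofKernelToBCF [TopologicalSpace X] {C : ℝ} (hC : ∀ x, ‖K x x‖ ≤ C)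
    (hc : ∀ y v, Continuous fun x => K x y v) : RKHS.OfKernel K →L[ℂ] (X →ᵇ H) :=
  LinearMap.mkContinuous
    { toFun := fun F => BoundedContinuousFunction.ofNormedAddCommGroup F
        (continuous_ofKernel hC hc F) _ (norm_ofKernel_apply_le hC F)
      map_add' := fun F G => by ext x; simp
      map_smul' := fun c F => by ext x; simp } (√C) fun F =>
    BoundedContinuousFunction.norm_ofNormedAddCommGroup_le _ (by positivity)
      (norm_ofKernel_apply_le hC F)

end OfKernel

theorem continuous_of_mem_rkhs [TopologicalSpace X] {K : X → X → H →L[ℂ] H} {C : ℝ}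
    (hC : ∀ x y, ‖K x y‖ ≤ C) (hc : ∀ y v, Continuous fun x => K x y v) {f : X → H}
    (hf : f ∈ rkhs K) : Continuous f := by
  obtain ⟨hK, F, rfl⟩ := hf
  have : Fact (Matrix.of K).PosSemidef := ⟨hK.posSemidef⟩
  exact continuous_ofKernel (K := Matrix.of K) (fun x => hC x x) hc F

theorem section_mem_rkhs {K : X → X → H →L[ℂ] H} (hK : IsPosDef K) (y : X) (v : H) :
    (fun x => K x y v) ∈ rkhs K := by
  have : Fact (Matrix.of K).PosSemidef := ⟨hK.posSemidef⟩
  refine ⟨hK, RKHS.kerFun (RKHS.OfKernel (Matrix.of K)) y v, ?_⟩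
  ext x
  rw [kerFun_ofKernel_apply]
  rfl

theorem rkhs_bounded [TopologicalSpace X] {K : X → X → H →L[ℂ] H} {C : ℝ}
    (hC : ∀ x y, ‖K x y‖ ≤ C) {f : X → H}
    (hf : f ∈ rkhs K) : ∃ D, ∀ x, ‖f x‖ ≤ D := by
  obtain ⟨hK, F, rfl⟩ := hf
  have : Fact (Matrix.of K).PosSemidef := ⟨hK.posSemidef⟩
  exact ⟨_, norm_ofKernel_apply_le (K := Matrix.of K) (fun x => hC x x) F⟩

theorem add_mem_rkhs {K : X → X → H →L[ℂ] H} {f g : X → H} (hf : f ∈ rkhs K)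
    (hg : g ∈ rkhs K) : f + g ∈ rkhs K := by
  obtain ⟨hK, F, rfl⟩ := hf
  obtain ⟨_, G, rfl⟩ := hg
  have : Fact (Matrix.of K).PosSemidef := ⟨hK.posSemidef⟩
  exact ⟨hK, F + G, (RKHS.coe_add F G).symm⟩

theorem smul_mem_rkhs {K : X → X → H →L[ℂ] H} {f : X → H} (c : ℂ) (hf : f ∈ rkhs K) :
    c • f ∈ rkhs K := by
  obtain ⟨hK, F, rfl⟩ := hf
  have : Fact (Matrix.of K).PosSemidef := ⟨hK.posSemidef⟩
  exact ⟨hK, c • F, (RKHS.coe_smul F c).symm⟩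

theorem zero_mem_rkhs {K : X → X → H →L[ℂ] H} (hK : IsPosDef K) : (0 : X → H) ∈ rkhs K := by
  have : Fact (Matrix.of K).PosSemidef := ⟨hK.posSemidef⟩
  exact ⟨hK, 0, RKHS.coe_zero.symm⟩

/-- The restriction of a bounded functional to a reproducing kernel Hilbert space is represented
by an element of the space. -/
theorem exists_representer [TopologicalSpace X] {K : X → X → H →L[ℂ] H} (hK : IsPosDef K) {C : ℝ}
    (hC : ∀ x y, ‖K x y‖ ≤ C) {κ : X → H → X →ᵇ H} (hκ : ∀ y v x, κ y v x = K x y v)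
    (L : (X →ᵇ H) →L[ℂ] ℂ) :
    ∃ f : X →ᵇ H, ⇑f ∈ rkhs K ∧ (∀ y v, inner ℂ (f y) v = L (κ y v)) ∧ 0 ≤ L f ∧
      (L f = 0 → f = 0) ∧ (f = 0 → ∀ g : X →ᵇ H, ⇑g ∈ rkhs K → L g = 0) := by
  have : Fact (Matrix.of K).PosSemidef := ⟨hK.posSemidef⟩
  have hc : ∀ y v, Continuous fun x => Matrix.of K x y v := fun y v =>
    (κ y v).continuous.congr (hκ y v)
  let T := ofKernelToBCF (K := Matrix.of K) (fun x => hC x x) hc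
  have hT : ∀ F x, T F x = F x := fun F x => rfl
  let F := (InnerProductSpace.toDual ℂ _).symm (L.comp T)
  have hF : ∀ G, inner ℂ F G = L (T G) := fun G => InnerProductSpace.toDual_symm_apply
  -- Evaluating the functional at its own representer gives the squared norm. This is the source of
  -- all the positivity below.
  have hLF : L (T F) = (‖F‖ : ℂ) ^ 2 := by rw [← hF, inner_self_eq_norm_sq_to_K]; rfl
  refine ⟨T F, ⟨hK, F, rfl⟩, fun y v => ?_, ?_, fun h => ?_, fun h g hg => ?_⟩
  · rw [hT, ← RKHS.inner_kerFun, hF]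
    congr 1
    ext x
    rw [hT, kerFun_ofKernel_apply, hκ]
    rfl
  · rw [hLF]
    exact_mod_cast sq_nonneg ‖F‖
  · rw [hLF] at h
    have : F = 0 := by simpa using h
    rw [this, map_zero]
  · have hF0 : F = 0 := by
      ext x
      rw [← hT, h]
      simp
    obtain ⟨_, G, hG⟩ := hg
    have : g = T G := by
      ext x
      rw [hT, hG]
    rw [this, ← hF, hF0, inner_zero_left]

end ReproducingKernels

/-! ### Universality as a statement about annihilating functionals -/

section Universality

/-- A functional on `C(A, H)` that vanishes on the functions `f • v` is zero. -/
theorem eq_zero_of_tensor {X H : Type*} [TopologicalSpace X] [NormedAddCommGroup H]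
    [InnerProductSpace ℂ H] [CompactSpace X] {L : C(X, H) →L[ℂ] ℂ}
    (hL : ∀ f v, L (tensorC X f v) = 0) : L = 0 := by
  ext g
  refine norm_le_zero_iff.1 (le_of_forall_pos_lt_add fun ε hε => ?_)
  have hδ : 0 < ε / (‖L‖ + 1) := by positivity
  obtain ⟨t, htf, ht⟩ :=
    Metric.totallyBounded_iff.1 (isCompact_range g.continuous).totallyBounded _ hδ
  -- The centres of a finite net of the compact range span a finite-dimensional space. Projecting
  -- `g` onto it gives a finite sum of tensors, and the projection is at least as close to `g x` as
  -- the nearest centre.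
  let V := Submodule.span ℂ t
  have : FiniteDimensional ℂ V := FiniteDimensional.span_of_finite ℂ htf
  let b := stdOrthonormalBasis ℂ V
  let c : Fin (Module.finrank ℂ V) → C(X, ℂ) := fun i =>
    ⟨fun x => inner ℂ (b i : H) (g x), continuous_const.inner g.continuous⟩
  have hsum : ∀ x, (∑ i, tensorC X (c i) (b i : H)) x = V.starProjection (g x) := by
    intro x
    rw [ContinuousMap.sum_apply, b.starProjection_eq_sum_rankOne, _root_.sum_apply]
    rfl
  have h1 : L (∑ i, tensorC X (c i) (b i : H)) = 0 := by
    rw [map_sum]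
    exact Finset.sum_eq_zero fun i _ => hL _ _
  have h2 : ‖g - ∑ i, tensorC X (c i) (b i : H)‖ ≤ ε / (‖L‖ + 1) := by
    rw [ContinuousMap.norm_le _ hδ.le]
    intro x
    rw [ContinuousMap.sub_apply, hsum]
    obtain ⟨z, hz, hxz⟩ := mem_iUnion₂.1 (ht (mem_range_self x))
    rw [Submodule.starProjection_minimal]
    refine (ciInf_le ⟨0, ?_⟩ (⟨z, Submodule.subset_span hz⟩ : V)).trans ?_
    · rintro _ ⟨y, rfl⟩
      exact norm_nonneg _
    · rw [← dist_eq_norm]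
      exact (Metric.mem_ball.1 hxz).le
  have h3 : L g = L (g - ∑ i, tensorC X (c i) (b i : H)) := by rw [map_sub, h1, sub_zero]
  rw [h3, zero_add]
  calc _ ≤ ‖L‖ * (ε / (‖L‖ + 1)) := (L.le_opNorm _).trans (by gcongr)
    _ < (‖L‖ + 1) * (ε / (‖L‖ + 1)) := by gcongr; linarith
    _ = ε := by field_simp

variable {X H : Type*} [TopologicalSpace X] [NormedAddCommGroup H] [InnerProductSpace ℂ H]
  [CompleteSpace H]

/-- Hahn–Banach: if the restrictions to `A` were not dense, a nonzero functional would annihilate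
them, in particular the kernel sections. -/
theorem isUniversal_of_dual {K : X → X → H →L[ℂ] H} (hK : IsPosDef K) {C : ℝ}
    (hC : ∀ x y, ‖K x y‖ ≤ C) {κ : X → H → X →ᵇ H} (hκ : ∀ y v x, κ y v x = K x y v)
    (h : ∀ A : Set X, IsCompact A → ∀ L : C(A, H) →L[ℂ] ℂ,
      (∀ y v, L ((κ y v).toContinuousMap.restrict A) = 0) → L = 0) : IsUniversal K := by
  have hcont : ∀ f ∈ rkhs K, Continuous f := fun f hf =>
    continuous_of_mem_rkhs hC (fun y v => (κ y v).continuous.congr (hκ y v)) hf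
  refine ⟨hK, hcont, fun A hA g ε hε => ?_⟩
  have := isCompact_iff_compactSpace.1 hA
  let S : Submodule ℂ C(A, H) :=
    { carrier := {g | ∃ f ∈ rkhs K, ∀ x : A, f x = g x}
      add_mem' := by
        rintro g g' ⟨f, hf, hfg⟩ ⟨f', hf', hfg'⟩
        exact ⟨f + f', add_mem_rkhs hf hf', fun x => by simp [hfg, hfg']⟩
      zero_mem' := ⟨0, zero_mem_rkhs hK, fun x => rfl⟩
      smul_mem' := by
        rintro c g ⟨f, hf, hfg⟩
        exact ⟨c • f, smul_mem_rkhs c hf, fun x => by simp [hfg]⟩ }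
  have hS : g ∈ S.topologicalClosure := by
    by_contra hg
    obtain ⟨L, hL, hLg⟩ : ∃ L : C(A, H) →L[ℂ] ℂ, (∀ s ∈ S, L s = 0) ∧ L g ≠ 0 := by
      -- The quotient norm is the distance to `S`, so a norming functional of the class of `g`
      -- separates `g` from `S`.
      have hne : ‖(Submodule.Quotient.mk g : C(A, H) ⧸ S)‖ ≠ 0 := fun h =>
        hg (QuotientAddGroup.norm_mk_eq_zero_iff_mem_closure (S := S.toAddSubgroup).1 h)
      obtain ⟨L, -, hL⟩ := exists_dual_vector ℂ _ hne
      refine ⟨L.comp S.mkQL, fun s hs => ?_, ?_⟩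
      · have : S.mkQL s = 0 := (Submodule.Quotient.mk_eq_zero S).2 hs
        rw [ContinuousLinearMap.comp_apply, this, map_zero]
      · have : L.comp S.mkQL g = L (Submodule.Quotient.mk g) := rfl
        rw [this, hL]
        exact Complex.ofReal_ne_zero.2 hne
    refine hLg ?_
    rw [h A hA L fun y v => hL _ ⟨_, section_mem_rkhs hK y v, fun x => (hκ y v x).symm⟩]
    rfl
  obtain ⟨f', ⟨f, hf, hff⟩, hd⟩ := Metric.mem_closure_iff.1 hS ε hε
  refine ⟨f, hf, fun x => ?_⟩
  rw [hff, ← dist_eq_norm, dist_comm]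
  exact (ContinuousMap.dist_apply_le_dist x).trans_lt hd

/-- A functional on `C(A, H)` that vanishes on a universal reproducing kernel Hilbert space is
zero. -/
theorem IsUniversal.eq_zero_of_vanish {K : X → X → H →L[ℂ] H} (hK : IsUniversal K) {C : ℝ}
    (hC : ∀ x y, ‖K x y‖ ≤ C) {κ : X → H → X →ᵇ H} (hκ : ∀ y v x, κ y v x = K x y v)
    {A : Set X} (hA : IsCompact A) {L : C(A, H) →L[ℂ] ℂ}
    (hL : ∀ y v, L ((κ y v).toContinuousMap.restrict A) = 0) : L = 0 := by
  have := isCompact_iff_compactSpace.1 hA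
  obtain ⟨f, -, hf, -, -, h0⟩ := exists_representer hK.posDef hC hκ (L.comp (restrictCLM A))
  -- Vanishing on the sections kills the representer, hence `L` on the whole reproducing kernel
  -- space.
  have hf0 : f = 0 := by
    ext y
    refine ext_inner_right ℂ fun v => ?_
    rw [hf, ContinuousLinearMap.comp_apply, restrictCLM_apply, hL]
    simp
  ext g
  refine norm_le_zero_iff.1 (le_of_forall_pos_lt_add fun ε hε => ?_)
  obtain ⟨f', hf', hd⟩ := hK.dense A hA g (ε / (‖L‖ + 1)) (by positivity)
  obtain ⟨D, hD⟩ := rkhs_bounded hC hf'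
  let F := BoundedContinuousFunction.ofNormedAddCommGroup f' (hK.continuous f' hf') D hD
  have h1 : L (F.toContinuousMap.restrict A) = 0 := h0 hf0 F hf'
  have h2 : ‖g - F.toContinuousMap.restrict A‖ ≤ ε / (‖L‖ + 1) := by
    rw [ContinuousMap.norm_le _ (by positivity)]
    intro x
    rw [← norm_neg]
    simpa using! (hd x).le
  have h3 : L g = L (g - F.toContinuousMap.restrict A) := by rw [map_sub, h1, sub_zero]
  rw [h3, zero_add]
  calc _ ≤ ‖L‖ * (ε / (‖L‖ + 1)) := (L.le_opNorm _).trans (by gcongr)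
    _ < (‖L‖ + 1) * (ε / (‖L‖ + 1)) := by gcongr; linarith
    _ = ε := by field_simp

end Universality

/-! ### Products of a scalar kernel with a positive operator -/

section Schur

variable {X H : Type*} [NormedAddCommGroup H] [InnerProductSpace ℂ H] [CompleteSpace H]

theorem inner_ofScalar (k : X → X → ℂ) (x y : X) (a b : ℂ) :
    inner ℂ a (ofScalar k x y b) = star a * k x y * b := by
  simp [ofScalar]
  ring

theorem exists_sqrt_of_isPositive {G : H →L[ℂ] H} (hG : G.IsPositive) :
    ∃ S : H →L[ℂ] H, ∀ a b, inner ℂ a (G b) = inner ℂ (S a) (S b) := by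
  have h : 0 ≤ G := (ContinuousLinearMap.nonneg_iff_isPositive G).2 hG
  obtain ⟨S, rfl⟩ := CStarAlgebra.nonneg_iff_eq_star_mul_self.1 h
  refine ⟨S, fun a b => ?_⟩
  rw [ContinuousLinearMap.star_eq_adjoint, FunLike.coe_mul_eq_comp, Function.comp_apply,
    ContinuousLinearMap.adjoint_inner_right]

/-- With `G = S* S`, the coefficients `c i x` are the coordinates of `S (v x)` in an orthonormal
basis of the span of these finitely many vectors. Parseval splits the operator form into scalar
forms of `k`, and vanishing coordinates mean `S (v x) = 0`. -/
theorem sum_smul_eq {G : H →L[ℂ] H} (hG : G.IsPositive) (s : Finset X) (v : X → H) :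
    ∃ (n : ℕ) (c : Fin n → X → ℂ),
      (∀ k : X → X → ℂ, ∑ x ∈ s, ∑ y ∈ s, inner ℂ (v x) ((k x y • G) (v y)) =
        ∑ i, ∑ x ∈ s, ∑ y ∈ s, inner ℂ (c i x) (ofScalar k x y (c i y))) ∧
      ((∀ i, ∀ x ∈ s, c i x = 0) → ∀ x ∈ s, inner ℂ (v x) (G (v x)) = 0) := by
  obtain ⟨S, hin⟩ := exists_sqrt_of_isPositive hG
  let V := Submodule.span ℂ ((fun x => S (v x)) '' s)
  have : FiniteDimensional ℂ V := FiniteDimensional.span_of_finite ℂ (s.finite_toSet.image _)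
  let b := stdOrthonormalBasis ℂ V
  have hmem : ∀ x ∈ s, S (v x) ∈ V := fun x hx =>
    Submodule.subset_span (mem_image_of_mem _ (Finset.mem_coe.2 hx))
  have hexp : ∀ x ∈ s, ∀ y ∈ s, inner ℂ (v x) (G (v y)) =
      ∑ i, star (inner ℂ (b i : H) (S (v x))) * inner ℂ (b i : H) (S (v y)) := by
    intro x hx y hy
    have := b.sum_inner_mul_inner (⟨_, hmem x hx⟩ : V) ⟨_, hmem y hy⟩
    rw [hin]
    refine this.symm.trans (Finset.sum_congr rfl fun i _ => ?_)
    simp only [Submodule.coe_inner]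
    rw [← inner_conj_symm]
    rfl
  refine ⟨_, fun i x => inner ℂ (b i : H) (S (v x)), fun k => ?_, fun h x hx => ?_⟩
  · refine Eq.trans (Finset.sum_congr rfl fun x hx => ?_) Finset.sum_comm
    refine Eq.trans ?_ Finset.sum_comm
    refine Finset.sum_congr rfl fun y hy => ?_
    rw [_root_.smul_apply, inner_smul_right, hexp x hx y hy, Finset.mul_sum]
    refine Finset.sum_congr rfl fun i _ => ?_
    rw [inner_ofScalar]
    ring
  · rw [hexp x hx x hx]
    exact Finset.sum_eq_zero fun i _ => mul_eq_zero_of_right _ (h i x hx)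

theorem IsPosDef.smul {k : X → X → ℂ} (hk : IsPosDef (ofScalar k)) {G : H →L[ℂ] H}
    (hG : G.IsPositive) : IsPosDef fun x y => k x y • G := by
  intro s v
  obtain ⟨n, c, hc, -⟩ := sum_smul_eq hG s v
  rw [hc]
  exact Finset.sum_nonneg fun i _ => hk s (c i)

theorem IsStrictlyPosDef.inner_eq_zero {k : X → X → ℂ} (hk : IsStrictlyPosDef (ofScalar k))
    {G : H →L[ℂ] H} (hG : G.IsPositive) {s : Finset X} {v : X → H}
    (h : ∑ x ∈ s, ∑ y ∈ s, inner ℂ (v x) ((k x y • G) (v y)) = 0) :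
    ∀ x ∈ s, inner ℂ (v x) (G (v x)) = 0 := by
  obtain ⟨n, c, hc, h0⟩ := sum_smul_eq hG s v
  rw [hc, Finset.sum_eq_zero_iff_of_nonneg fun i _ => hk.1 s (c i)] at h
  exact h0 fun i => hk.2 s (c i) (h i (Finset.mem_univ i))

end Schur

/-! ### Strong measurability on σ-compact sets -/

section Measurability

variable {Ω : Type*} [TopologicalSpace Ω] [MeasurableSpace Ω]

theorem aestronglyMeasurable_of_sigmaCompact [OpensMeasurableSpace Ω] {μ : Measure Ω} {S : Set Ω}
    (hS : IsSigmaCompact S) (hμ : μ Sᶜ = 0) {M : Type*} [TopologicalSpace M]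
    [TopologicalSpace.PseudoMetrizableSpace M] {f : Ω → M} (hf : Continuous f) :
    AEStronglyMeasurable f μ := by
  borelize M
  refine aestronglyMeasurable_iff_aemeasurable_separable.2
    ⟨hf.aemeasurable, f '' S, ?_, ?_⟩
  · obtain ⟨K, hK, rfl⟩ := hS
    rw [image_iUnion]
    exact .iUnion fun n => ((hK n).image hf).isSeparable
  · have : S ∈ ae μ := mem_ae_iff.2 hμ
    filter_upwards [this] with w hw using mem_image_of_mem f hw

end Measurability

/-! ### Exchanging tight functionals with integrals -/

section Fubini

variable {Ω X H : Type*} [TopologicalSpace X] [MeasurableSpace Ω] [NormedAddCommGroup H]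
  [NormedSpace ℂ H] [CompleteSpace H]

/-- The integral `Ψ` is known only pointwise. After restriction to a compact set it becomes a
Bochner integral in `C(A, H)`, which commutes with bounded operators; tightness and dominated
convergence recover `L`. -/
theorem IsTight.integral_eq {L : (X →ᵇ H) →L[ℂ] ℂ} (hL : IsTight L) {μ : Measure Ω}
    {Φ : Ω → X →ᵇ H} {Ψ : X →ᵇ H} {b : Ω → ℝ} (hb : Integrable b μ) (hΦ : ∀ w, ‖Φ w‖ ≤ b w)
    (hm : ∀ A : Set X, IsCompact A →
      AEStronglyMeasurable (fun w => (Φ w).toContinuousMap.restrict A) μ)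
    (hΨ : ∀ x, Ψ x = ∫ w, Φ w x ∂μ) :
    Integrable (fun w => L (Φ w)) μ ∧ L Ψ = ∫ w, L (Φ w) ∂μ := by
  have hb0 : ∀ w, 0 ≤ b w := fun w => (norm_nonneg _).trans (hΦ w)
  choose A hA S hS using fun n : ℕ => hL (1 / ((n : ℝ) + 1)) (by positivity)
  have hlim : ∀ f : X →ᵇ H, Tendsto (fun n => S n (f.toContinuousMap.restrict (A n))) atTop
      (𝓝 (L f)) := by
    intro f
    rw [tendsto_iff_norm_sub_tendsto_zero]
    refine squeeze_zero (fun _ => norm_nonneg _) (fun n => ?_)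
      (by simpa only [zero_mul] using
        (tendsto_one_div_add_atTop_nhds_zero_nat (𝕜 := ℝ)).mul_const ‖f‖)
    rw [norm_sub_rev]
    exact hS n f
  have hSm : ∀ n, AEStronglyMeasurable
      (fun w => S n ((Φ w).toContinuousMap.restrict (A n))) μ := fun n =>
    (S n).continuous.comp_aestronglyMeasurable (hm _ (hA n))
  have hint : Integrable (fun w => L (Φ w)) μ := by
    refine (hb.const_mul ‖L‖).mono'
      (aestronglyMeasurable_of_tendsto_ae atTop hSm (.of_forall fun w => hlim (Φ w)))
      (.of_forall fun w => ?_)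
    grw [L.le_opNorm, hΦ w]
  refine ⟨hint, tendsto_nhds_unique (hlim Ψ) ?_⟩
  have hSΨ : ∀ n, S n (Ψ.toContinuousMap.restrict (A n)) =
      ∫ w, S n ((Φ w).toContinuousMap.restrict (A n)) ∂μ := by
    intro n
    have := isCompact_iff_compactSpace.1 (hA n)
    have hi : Integrable (fun w => (Φ w).toContinuousMap.restrict (A n)) μ := by
      refine hb.mono' (hm _ (hA n)) (.of_forall fun w => ?_)
      refine ((ContinuousMap.norm_le _ (norm_nonneg (Φ w))).2 fun x => ?_).trans (hΦ w)
      exact (Φ w).norm_coe_le_norm x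
    rw [(S n).integral_comp_comm hi]
    congr 1
    ext x
    have := (ContinuousMap.evalCLM ℂ x).integral_comp_comm hi
    simp only [ContinuousMap.evalCLM_apply] at this
    rw [← this]
    exact hΨ x
  simp only [hSΨ]
  -- The errors are `1 / (n + 1) ≤ 1`, so adding one to `‖L‖` dominates every approximant.
  refine tendsto_integral_of_dominated_convergence (fun w => (‖L‖ + 1) * b w) hSm
    (hb.const_mul _) (fun n => .of_forall fun w => ?_) (.of_forall fun w => hlim (Φ w))
  have h1 := hS n (Φ w)
  have h2 : (1 : ℝ) / (n + 1) ≤ 1 := by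
    rw [div_le_one (by positivity)]
    linarith [(Nat.cast_nonneg n : (0 : ℝ) ≤ n)]
  have h3 : ‖L (Φ w)‖ ≤ ‖L‖ * b w := by grw [L.le_opNorm, hΦ w]
  have h4 : 1 / ((n : ℝ) + 1) * ‖Φ w‖ ≤ 1 * b w := by
    gcongr
    exact hΦ w
  calc _ ≤ ‖L (Φ w)‖ + ‖L (Φ w) - S n ((Φ w).toContinuousMap.restrict (A n))‖ := by
        rw [norm_sub_rev]; exact norm_le_insert' _ _
    _ ≤ ‖L‖ * b w + 1 * b w := by gcongr; exact h1.trans h4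
    _ = _ := by ring

end Fubini

/-! ### Sections of the scalar kernels -/

section Mixture

variable {Ω X H : Type*} [TopologicalSpace X] [TopologicalSpace Ω] [MeasurableSpace Ω]
  [NormedAddCommGroup H] [InnerProductSpace ℂ H]

/-- The sections `p_w(·, y)` as bounded continuous functions. -/
def sectionX {p : Ω → X → X → ℂ} (hp : Continuous fun q : Ω × X × X => p q.1 q.2.1 q.2.2) {C : ℝ}
    (hC : ∀ w x y, ‖p w x y‖ ≤ C) (w : Ω) (y : X) : X →ᵇ ℂ :=
  BoundedContinuousFunction.ofNormedAddCommGroup (fun x => p w x y) (by fun_prop) C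
    fun x => hC w x y

/-- The sections `p(x, y)` as bounded continuous functions on the parameter space. -/
def sectionΩ {p : Ω → X → X → ℂ} (hp : Continuous fun q : Ω × X × X => p q.1 q.2.1 q.2.2) {C : ℝ}
    (hC : ∀ w x y, ‖p w x y‖ ≤ C) (x y : X) : Ω →ᵇ ℂ :=
  BoundedContinuousFunction.ofNormedAddCommGroup (fun w => p w x y) (by fun_prop) C
    fun w => hC w x y

end Mixture

/-! ### Passing from the mixture to almost every component -/

section Vanishing

variable {Ω X H : Type*} [TopologicalSpace X] [TopologicalSpace Ω]
  [NormedAddCommGroup H] [InnerProductSpace ℂ H]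
  {p : Ω → X → X → ℂ} {C : ℝ} (hp : Continuous fun q : Ω × X × X => p q.1 q.2.1 q.2.2)
  (hC : ∀ w x y, ‖p w x y‖ ≤ C)

theorem norm_sectionX_le (hC0 : 0 ≤ C) (w : Ω) (y : X) : ‖sectionX hp hC w y‖ ≤ C :=
  BoundedContinuousFunction.norm_ofNormedAddCommGroup_le _ hC0 _

theorem integral_functional_section_eq_zero [MeasurableSpace Ω] [OpensMeasurableSpace Ω]
    [CompleteSpace H] (hC0 : 0 ≤ C)
    {μ : Measure Ω} {S : Set Ω} (hS : IsSigmaCompact S) (hμ : μ Sᶜ = 0)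
    {G : Ω → H →L[ℂ] H} (hG : Integrable G μ)
    {κ : X → H → X →ᵇ H} (hκ : ∀ y v x, κ y v x = ∫ w, p w x y • G w v ∂μ)
    {L : (X →ᵇ H) →L[ℂ] ℂ} (hL : IsTight L) (h0 : ∀ y v, L (κ y v) = 0) (y : X) (v : H) :
    ∫ w, L (tensorCLM X (sectionX hp hC w y) (G w v)) ∂μ = 0 := by
  rw [← h0 y v]
  refine (hL.integral_eq (b := fun w => C * (‖G w‖ * ‖v‖)) (hG.norm.mul_const _ |>.const_mul C)
    (fun w => ?_) (fun A hA => ?_) (hκ y v)).2.symm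
  · rw [BoundedContinuousFunction.norm_le (by positivity)]
    intro x
    rw [tensorCLM_apply, norm_smul]
    gcongr
    · exact hC w x y
    · exact (G w).le_opNorm v
  · have := isCompact_iff_compactSpace.1 hA
    have h1 : Continuous fun w => (sectionX hp hC w y).toContinuousMap.restrict A :=
      continuous_restrict_of_continuous A (φ := fun w => sectionX hp hC w y)
        (show Continuous fun q : Ω × X => p q.1 q.2 y by fun_prop)
    have h2 : Continuous fun q : C(A, ℂ) × H => tensorC A q.1 q.2 := by
      refine ContinuousMap.continuous_of_continuous_uncurry _ ?_
      change Continuous fun q : (C(A, ℂ) × H) × A => q.1.1 q.2 • q.1.2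
      fun_prop
    exact h2.comp_aestronglyMeasurable
      ((aestronglyMeasurable_of_sigmaCompact hS hμ h1).prodMk
        ((ContinuousLinearMap.apply ℂ H v).continuous.comp_aestronglyMeasurable hG.1))

variable [CompleteSpace H]

/-- The vectors `z` with `⟨z, u⟩ = L (p_w(·, y) u)`. -/
def fieldOf (L : (X →ᵇ H) →L[ℂ] ℂ) (w : Ω) (y : X) : H :=
  (InnerProductSpace.toDual ℂ H).symm (slice L (sectionX hp hC w y))

theorem inner_fieldOf (L : (X →ᵇ H) →L[ℂ] ℂ) (w : Ω) (y : X) (u : H) :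
    inner ℂ (fieldOf hp hC L w y) u = L (tensorCLM X (sectionX hp hC w y) u) :=
  InnerProductSpace.toDual_symm_apply

theorem continuous_fieldOf (hC0 : 0 ≤ C) {L : (X →ᵇ H) →L[ℂ] ℂ} (hL : IsTight L) :
    Continuous fun q : Ω × X => fieldOf hp hC L q.1 q.2 :=
  (InnerProductSpace.toDual ℂ H).symm.continuous.comp
    (hL.slice.continuous (φ := fun q : Ω × X => sectionX hp hC q.1 q.2)
      (fun q => norm_sectionX_le hp hC hC0 q.1 q.2)
      (show Continuous fun q : (Ω × X) × X => p q.1.1 q.2 q.1.2 by fun_prop))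

theorem norm_fieldOf_le (hC0 : 0 ≤ C) (L : (X →ᵇ H) →L[ℂ] ℂ) (w : Ω) (y : X) :
    ‖fieldOf hp hC L w y‖ ≤ ‖slice L‖ * C := by
  rw [fieldOf, LinearIsometryEquiv.norm_map]
  grw [(slice L).le_opNorm, norm_sectionX_le hp hC hC0]

theorem continuous_fieldOf_right (hC0 : 0 ≤ C) {L : (X →ᵇ H) →L[ℂ] ℂ} (hL : IsTight L) (w : Ω) :
    Continuous fun y => fieldOf hp hC L w y :=
  (continuous_fieldOf hp hC hC0 hL).comp (g := fun q : Ω × X => fieldOf hp hC L q.1 q.2)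
    (f := fun y => (w, y)) (Continuous.prodMk_right w)

theorem continuous_fieldOf_left (hC0 : 0 ≤ C) {L : (X →ᵇ H) →L[ℂ] ℂ} (hL : IsTight L) (y : X) :
    Continuous fun w => fieldOf hp hC L w y :=
  (continuous_fieldOf hp hC hC0 hL).comp (g := fun q : Ω × X => fieldOf hp hC L q.1 q.2)
    (f := fun w => (w, y)) (Continuous.prodMk_left y)

/-- The vector fields `y ↦ z w y` as bounded continuous functions. -/
def fieldBCF (hC0 : 0 ≤ C) {L : (X →ᵇ H) →L[ℂ] ℂ} (hL : IsTight L) (w : Ω) : X →ᵇ H :=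
  BoundedContinuousFunction.ofNormedAddCommGroup (fun y => fieldOf hp hC L w y)
    (continuous_fieldOf_right hp hC hC0 hL w) (‖slice L‖ * C)
    (norm_fieldOf_le hp hC hC0 L w)

/-- The representer of `L` in the reproducing kernel Hilbert space of `p_w G(w)`. -/
def densityField (hC0 : 0 ≤ C) {L : (X →ᵇ H) →L[ℂ] ℂ} (hL : IsTight L) (G : Ω → H →L[ℂ] H)
    (w : Ω) : X →ᵇ H :=
  (G w).compLeftContinuousBounded X (fieldBCF hp hC hC0 hL w)

theorem densityField_apply (hC0 : 0 ≤ C) {L : (X →ᵇ H) →L[ℂ] ℂ} (hL : IsTight L)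
    (G : Ω → H →L[ℂ] H) (w : Ω) (y : X) :
    densityField hp hC hC0 hL G w y = G w (fieldOf hp hC L w y) := rfl

theorem norm_densityField_le (hC0 : 0 ≤ C) {L : (X →ᵇ H) →L[ℂ] ℂ} (hL : IsTight L)
    (G : Ω → H →L[ℂ] H) (w : Ω) :
    ‖densityField hp hC hC0 hL G w‖ ≤ ‖G w‖ * (‖slice L‖ * C) := by
  rw [BoundedContinuousFunction.norm_le (by positivity)]
  intro y
  rw [densityField_apply]
  grw [(G w).le_opNorm, norm_fieldOf_le hp hC hC0]

theorem inner_densityField (hC0 : 0 ≤ C) {L : (X →ᵇ H) →L[ℂ] ℂ} (hL : IsTight L)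
    {G : Ω → H →L[ℂ] H} {w : Ω} (hw : (G w).IsPositive) (y : X) (v : H) :
    inner ℂ (densityField hp hC hC0 hL G w y) v =
      L (tensorCLM X (sectionX hp hC w y) (G w v)) := by
  rw [← inner_fieldOf, densityField_apply]
  exact hw.inner_left_eq_inner_right _ _

/-- The field has the inner products that characterize the Riesz representer of `L` for the kernel
`p_w G(w)`; hence `L` takes at it the value of a squared norm. -/
theorem functional_densityField (hC0 : 0 ≤ C) {L : (X →ᵇ H) →L[ℂ] ℂ} (hL : IsTight L)
    {G : Ω → H →L[ℂ] H} {w : Ω} (hw : (G w).IsPositive) (hpd : IsPosDef (ofScalar (p w))) :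
    0 ≤ L (densityField hp hC hC0 hL G w) ∧
      (L (densityField hp hC hC0 hL G w) = 0 → densityField hp hC hC0 hL G w = 0) := by
  obtain ⟨f, -, hf, hf0, hf1, -⟩ := exists_representer (hpd.smul hw) (C := C * ‖G w‖)
    (fun x y => by rw [norm_smul]; gcongr; exact hC w x y)
    (κ := fun y v => tensorCLM X (sectionX hp hC w y) (G w v)) (fun y v x => rfl) L
  have : f = densityField hp hC hC0 hL G w := by
    ext y
    refine ext_inner_right ℂ fun v => ?_
    rw [hf, inner_densityField hp hC hC0 hL hw]
  rw [← this]
  exact ⟨hf0, hf1⟩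

variable [MeasurableSpace Ω] [OpensMeasurableSpace Ω] {μ : Measure Ω} {S : Set Ω}
  {G : Ω → H →L[ℂ] H}

theorem aestronglyMeasurable_densityField [T2Space X] (hC0 : 0 ≤ C) {L : (X →ᵇ H) →L[ℂ] ℂ}
    (hL : IsTight L) (hS : IsSigmaCompact S) (hμ : μ Sᶜ = 0) (hG : AEStronglyMeasurable G μ)
    {A : Set X} (hA : IsCompact A) :
    AEStronglyMeasurable
      (fun w => (densityField hp hC hC0 hL G w).toContinuousMap.restrict A) μ := by
  have := isCompact_iff_compactSpace.1 hA
  have h1 : Continuous fun w => (fieldBCF hp hC hC0 hL w).toContinuousMap.restrict A :=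
    continuous_restrict_of_continuous A (φ := fieldBCF hp hC hC0 hL)
      (continuous_fieldOf hp hC hC0 hL)
  have h2 : Continuous fun q : (H →L[ℂ] H) × C(A, H) =>
      (q.1.compLeftContinuous ℂ A q.2 : C(A, H)) := by
    refine ContinuousMap.continuous_of_continuous_uncurry _ ?_
    change Continuous fun q : ((H →L[ℂ] H) × C(A, H)) × A => q.1.1 (q.1.2 q.2)
    fun_prop
  exact h2.comp_aestronglyMeasurable
    (hG.prodMk (aestronglyMeasurable_of_sigmaCompact hS hμ h1))

/-- Self-adjointness of `G w` turns the inner products with the field into conjugates of the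
integrands in `h0`. -/
theorem integral_densityField_eq_zero (hC0 : 0 ≤ C) {L : (X →ᵇ H) →L[ℂ] ℂ}
    (hL : IsTight L) (hS : IsSigmaCompact S) (hμ : μ Sᶜ = 0) (hG : Integrable G μ)
    (hGpos : ∀ᵐ w ∂μ, (G w).IsPositive)
    (h0 : ∀ y v, ∫ w, L (tensorCLM X (sectionX hp hC w y) (G w v)) ∂μ = 0) (y : X) :
    ∫ w, densityField hp hC hC0 hL G w y ∂μ = 0 := by
  have hi : Integrable (fun w => densityField hp hC hC0 hL G w y) μ := by
    refine (hG.norm.mul_const (‖slice L‖ * C)).mono' ?_ (.of_forall fun w => ?_)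
    · have h1 : Continuous fun q : (H →L[ℂ] H) × H => q.1 q.2 := by fun_prop
      exact h1.comp_aestronglyMeasurable (hG.1.prodMk (aestronglyMeasurable_of_sigmaCompact hS hμ
        (continuous_fieldOf_left hp hC hC0 hL y)))
    · exact (BoundedContinuousFunction.norm_coe_le_norm _ y).trans
        (norm_densityField_le hp hC hC0 hL G w)
  refine ext_inner_left ℂ fun v => ?_
  rw [inner_zero_right, ← integral_inner hi]
  have : ∀ᵐ w ∂μ, inner ℂ v (densityField hp hC hC0 hL G w y) =
      (starRingEnd ℂ) (L (tensorCLM X (sectionX hp hC w y) (G w v))) := by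
    filter_upwards [hGpos] with w hw
    rw [← inner_densityField hp hC hC0 hL hw, inner_conj_symm]
  rw [integral_congr_ae this, integral_conj, h0, map_zero]

/-- A tight functional that vanishes on the sections of the mixture vanishes on the sections
of almost every component. -/
theorem ae_vanish_of_vanish [T2Space X] (hC0 : 0 ≤ C) (hpd : ∀ w, IsPosDef (ofScalar (p w)))
    (hS : IsSigmaCompact S) (hμ : μ Sᶜ = 0)
    (hG : Integrable G μ) (hGpos : ∀ᵐ w ∂μ, (G w).IsPositive)
    {κ : X → H → X →ᵇ H} (hκ : ∀ y v x, κ y v x = ∫ w, p w x y • G w v ∂μ)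
    {L : (X →ᵇ H) →L[ℂ] ℂ} (hL : IsTight L) (h0 : ∀ y v, L (κ y v) = 0) :
    ∀ᵐ w ∂μ, ∀ y v, L (tensorCLM X (sectionX hp hC w y) (G w v)) = 0 := by
  have h1 := integral_functional_section_eq_zero hp hC hC0 hS hμ hG hκ hL h0
  -- The fields integrate to zero at each point, so the exchange is applied with `Ψ = 0`.
  have h2 := hL.integral_eq (μ := μ) (Φ := densityField hp hC hC0 hL G) (Ψ := 0)
    (hG.norm.mul_const _) (norm_densityField_le hp hC hC0 hL G)
    (fun A hA => aestronglyMeasurable_densityField hp hC hC0 hL hS hμ hG.1 hA)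
    (fun y => (integral_densityField_eq_zero hp hC hC0 hL hS hμ hG hGpos h1 y).symm)
  rw [map_zero] at h2
  have h3 : ∫ w, (L (densityField hp hC hC0 hL G w)).re ∂μ = 0 := by
    have := Complex.reCLM.integral_comp_comm h2.1
    rw [← h2.2, map_zero] at this
    exact this
  have h4 : 0 ≤ᵐ[μ] fun w => (L (densityField hp hC hC0 hL G w)).re := by
    filter_upwards [hGpos] with w hw
    exact (Complex.nonneg_iff.1 (functional_densityField hp hC hC0 hL hw (hpd w)).1).1
  -- This concerns a single function of `w`, so the exceptional null set depends on neither `y` nor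
  -- `v`.
  have h5 := (integral_eq_zero_iff_of_nonneg_ae h4 (Complex.reCLM.integrable_comp h2.1)).1 h3
  filter_upwards [hGpos, h5] with w hw hre y v
  obtain ⟨hpos, hzero⟩ := functional_densityField hp hC hC0 hL hw (hpd w)
  rw [← inner_densityField hp hC hC0 hL hw,
    hzero (Complex.ext hre (Complex.nonneg_iff.1 hpos).2.symm)]
  simp

end Vanishing

/-! ### Nonnegative complex integrands -/

section ComplexIntegrals

variable {Ω : Type*} [MeasurableSpace Ω] {μ : Measure Ω} {f : Ω → ℂ}

theorem integral_complex_nonneg (hf : Integrable f μ) (h : ∀ᵐ w ∂μ, 0 ≤ f w) :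
    0 ≤ ∫ w, f w ∂μ := by
  have h1 := Complex.reCLM.integral_comp_comm hf
  have h2 := Complex.imCLM.integral_comp_comm hf
  simp only [Complex.reCLM_apply, Complex.imCLM_apply] at h1 h2
  refine Complex.nonneg_iff.2 ⟨?_, ?_⟩
  · rw [← h1]
    exact integral_nonneg_of_ae (h.mono fun w hw => (Complex.nonneg_iff.1 hw).1)
  · rw [← h2]
    refine (integral_eq_zero_of_ae (h.mono fun w hw => ?_)).symm
    exact (Complex.nonneg_iff.1 hw).2.symm

theorem ae_eq_zero_of_integral_complex_eq_zero (hf : Integrable f μ) (h : ∀ᵐ w ∂μ, 0 ≤ f w)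
    (h0 : ∫ w, f w ∂μ = 0) : ∀ᵐ w ∂μ, f w = 0 := by
  have h1 := Complex.reCLM.integral_comp_comm hf
  rw [h0, map_zero] at h1
  have h2 := (integral_eq_zero_iff_of_nonneg_ae
    (h.mono fun w hw => (Complex.nonneg_iff.1 hw).1) (Complex.reCLM.integrable_comp hf)).1 h1
  filter_upwards [h, h2] with w hw hre
  exact Complex.ext hre (Complex.nonneg_iff.1 hw).2.symm

theorem ae_nonneg_of_forall_setIntegral_complex (hf : Integrable f μ)
    (h : ∀ A, MeasurableSet A → 0 ≤ ∫ w in A, f w ∂μ) : ∀ᵐ w ∂μ, 0 ≤ f w := by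
  have hre := ae_nonneg_of_forall_setIntegral_nonneg (Complex.reCLM.integrable_comp hf)
    fun A hA _ => by
      rw [Complex.reCLM.integral_comp_comm hf.integrableOn]
      exact (Complex.nonneg_iff.1 (h A hA)).1
  have him : ∀ A, MeasurableSet A → ∫ w in A, Complex.imCLM (f w) ∂μ = 0 := fun A hA => by
    rw [Complex.imCLM.integral_comp_comm hf.integrableOn]
    exact (Complex.nonneg_iff.1 (h A hA)).2.symm
  have him := (Complex.imCLM.integrable_comp hf).ae_eq_zero_of_forall_setIntegral_eq_zero
    fun A hA _ => him A hA
  filter_upwards [hre, him] with w h1 h2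
  exact Complex.nonneg_iff.2 ⟨h1, h2.symm⟩

end ComplexIntegrals

/-! ### Positive densities carried by σ-compact sets -/

section Density

/-- Separability permits one null set for a countable dense family of vectors; continuity of the
quadratic form covers the others. -/
theorem ae_isPositive {Ω H : Type*} [MeasurableSpace Ω] [NormedAddCommGroup H]
    [InnerProductSpace ℂ H] [CompleteSpace H] [TopologicalSpace.SeparableSpace H]
    {μ : Measure Ω} {G : Ω → H →L[ℂ] H}
    (hG : Integrable G μ) (h : ∀ A, MeasurableSet A → (∫ w in A, G w ∂μ).IsPositive) :
    ∀ᵐ w ∂μ, (G w).IsPositive := by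
  have key : ∀ v : H, ∀ᵐ w ∂μ, 0 ≤ inner ℂ v (G w v) := fun v => by
    let ℓ : (H →L[ℂ] H) →L[ℂ] ℂ := (innerSL ℂ v).comp (ContinuousLinearMap.apply ℂ H v)
    refine ae_nonneg_of_forall_setIntegral_complex (ℓ.integrable_comp hG) fun A hA => ?_
    have e : ∫ w in A, inner ℂ v (G w v) ∂μ = inner ℂ v ((∫ w in A, G w ∂μ) v) :=
      ℓ.integral_comp_comm hG.integrableOn
    rw [e]
    exact (h A hA).inner_nonneg_right v
  have hall := ae_all_iff.2 fun n => key (TopologicalSpace.denseSeq H n)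
  filter_upwards [hall] with w hw
  have hcl : IsClosed {v : H | 0 ≤ inner ℂ v (G w v)} := by
    have : Continuous fun v : H => inner ℂ v (G w v) := by fun_prop
    exact isClosed_Ici.preimage this
  have hv : ∀ v, 0 ≤ inner ℂ v (G w v) := fun v =>
    (TopologicalSpace.denseRange_denseSeq H).induction_on v hcl hw
  refine (ContinuousLinearMap.isPositive_iff_complex _).2 fun v => ?_
  obtain ⟨h1, h2⟩ := Complex.nonneg_iff.1 (hv v)
  rw [← inner_conj_symm (G w v) v]
  refine ⟨Complex.ext rfl ?_, h1⟩
  rw [Complex.conj_im, ← h2, neg_zero]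
  rfl

variable {Ω H : Type*} [TopologicalSpace Ω] [T2Space Ω] [MeasurableSpace Ω] [BorelSpace Ω]
  [NormedAddCommGroup H] [InnerProductSpace ℂ H] [CompleteSpace H]

/-- The given `μ` need not be regular, but `|Λ| = ‖G‖ μ` is. Compact sets exhaust `|Λ|` up to a null
set, so `G` vanishes `μ`-almost everywhere off their union and `μ` may be restricted to it. -/
theorem exists_density [TopologicalSpace.SeparableSpace H] {Λ : VectorMeasure Ω (H →L[ℂ] H)}
    (hpos : ∀ A, MeasurableSet A → (Λ A).IsPositive) (hrad : IsRadonBV Λ)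
    (hrn : HasRadonNikodym Λ) :
    ∃ (μ : Measure Ω) (G : Ω → H →L[ℂ] H) (S : Set Ω), IsSigmaCompact S ∧ μ Sᶜ = 0 ∧
      Integrable G μ ∧ (∀ᵐ w ∂μ, (G w).IsPositive) ∧
      ∀ A, MeasurableSet A → Λ A = ∫ w in A, G w ∂μ := by
  obtain ⟨μ, G, -, hG, hΛ⟩ := hrn
  have := hrad.finite
  have := hrad.regular
  have hvar : Λ.variation = μ.withDensity fun w => ‖G w‖ₑ := by
    rw [← Measure.variation_withDensityᵥ hG]
    congr 1
    ext A hA : 1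
    rw [hΛ A hA, withDensityᵥ_apply hG hA]
  choose K _ hK hlt using fun n : ℕ => MeasurableSet.univ.exists_isCompact_sdiff_lt
    (measure_ne_top Λ.variation univ) (ε := ((n : ENNReal) + 1)⁻¹) (by simp)
  let S := ⋃ n, K n
  have hSm : MeasurableSet S := .iUnion fun n => (hK n).measurableSet
  have hS0 : Λ.variation Sᶜ = 0 := by
    refine le_antisymm (ENNReal.le_of_forall_pos_le_add fun ε hε _ => ?_) zero_le
    obtain ⟨n, hn⟩ := ENNReal.exists_inv_nat_lt (ENNReal.coe_ne_zero.2 hε.ne')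
    rw [zero_add]
    calc Λ.variation Sᶜ ≤ Λ.variation (univ \ K n) := by
          refine measure_mono fun w hw => ⟨mem_univ _, fun h => hw (mem_iUnion_of_mem n h)⟩
      _ ≤ ((n : ENNReal) + 1)⁻¹ := (hlt n).le
      _ ≤ (n : ENNReal)⁻¹ := ENNReal.inv_le_inv.2 le_self_add
      _ ≤ ε := hn.le
  have hG0 : G =ᵐ[μ] S.indicator G := by
    rw [hvar, withDensity_apply _ hSm.compl,
      lintegral_eq_zero_iff' hG.1.enorm.restrict] at hS0
    filter_upwards [(ae_restrict_iff' hSm.compl).1 hS0] with w hw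
    by_cases hwS : w ∈ S
    · rw [indicator_of_mem hwS]
    · rw [indicator_of_notMem hwS]
      simpa using hw hwS
  have hΛ' : ∀ A, MeasurableSet A → Λ A = ∫ w in A, G w ∂(μ.restrict S) := by
    intro A hA
    rw [hΛ A hA, integral_congr_ae (ae_restrict_of_ae hG0), Measure.restrict_restrict hA,
      setIntegral_indicator hSm]
  refine ⟨μ.restrict S, G, S, isSigmaCompact_iUnion_of_isCompact _ hK, ?_, hG.restrict,
    ae_isPositive hG.restrict fun A hA => ?_, hΛ'⟩
  · rw [Measure.restrict_apply hSm.compl, compl_inter_self, measure_empty]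
  · rw [← hΛ' A hA]
    exact hpos A hA

end Density

/-! ### Radon measures: domination, images, point masses -/

section Regularity

variable {X : Type*} [TopologicalSpace X] [T2Space X] [MeasurableSpace X] [BorelSpace X]

theorem regular_of_exists_isCompact {ν : Measure X} [IsFiniteMeasure ν]
    (h : ∀ A, MeasurableSet A → ∀ ε : ENNReal, ε ≠ 0 → ∃ K ⊆ A, IsCompact K ∧ ν (A \ K) < ε) :
    ν.Regular := by
  have : ν.InnerRegularCompactLTTop := by
    refine ⟨fun A hA r hr => ?_⟩
    obtain ⟨K, hKA, hK, hlt⟩ := h A hA.1 (ν A - r) (tsub_pos_of_lt hr).ne'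
    refine ⟨K, hKA, hK, lt_of_not_ge fun hle => lt_irrefl (ν A) ?_⟩
    calc ν A ≤ ν (A \ K) + ν K := by
          refine (measure_mono ?_).trans (measure_union_le _ _)
          rw [sdiff_union_self]
          exact subset_union_left
      _ ≤ ν (A \ K) + r := by gcongr
      _ < (ν A - r) + r := ENNReal.add_lt_add_right (hr.trans_le le_top).ne hlt
      _ = ν A := tsub_add_cancel_of_le hr.le
  infer_instance

theorem regular_of_le {ν μ : Measure X} [IsFiniteMeasure μ] [μ.Regular] (h : ν ≤ μ) :
    ν.Regular := by
  have : IsFiniteMeasure ν := isFiniteMeasure_of_le μ h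
  refine regular_of_exists_isCompact fun A hA ε hε => ?_
  obtain ⟨K, hKA, hK, hlt⟩ := hA.exists_isCompact_sdiff_lt (measure_ne_top μ A) hε
  exact ⟨K, hKA, hK, (h _).trans_lt hlt⟩

variable {E F : Type*} [NormedAddCommGroup E] [NormedSpace ℝ E] [NormedAddCommGroup F]
  [NormedSpace ℝ F]

/-- The variation of the image is at most `‖φ‖` times that of `η`, and regularity passes to
dominated measures. -/
theorem IsRadonBV.mapRange {η : VectorMeasure X E} (hη : IsRadonBV η) (φ : E →L[ℝ] F) :
    IsRadonBV (η.mapRange (φ : E →+ F) φ.continuous) := by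
  have := hη.finite
  have := hη.regular
  have hle : (η.mapRange (φ : E →+ F) φ.continuous).variation ≤ ‖φ‖₊ • η.variation := by
    refine VectorMeasure.variation_le_of_forall_enorm_le fun A hA => ?_
    change ‖φ (η A)‖ₑ ≤ _
    refine (φ.le_opENorm (η A)).trans ?_
    rw [Measure.smul_apply, Measure.nnreal_smul_coe_apply]
    gcongr
    · exact le_rfl
    · exact VectorMeasure.enorm_measure_le_variation η A
  have : (‖φ‖₊ • η.variation).Regular := inferInstance
  exact ⟨isFiniteMeasure_of_le _ hle, regular_of_le hle⟩

theorem isRadonBV_dirac {X E : Type*} [TopologicalSpace X] [T2Space X] [MeasurableSpace X]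
    [BorelSpace X] [NormedAddCommGroup E] (x : X) (v : E) :
    IsRadonBV (VectorMeasure.dirac x v) := by
  have hvar : (VectorMeasure.dirac x v).variation = ‖v‖₊ • Measure.dirac x :=
    VectorMeasure.variation_dirac
  have : (Measure.dirac x).Regular := by
    refine regular_of_exists_isCompact fun A hA ε hε => ?_
    by_cases hx : x ∈ A
    · refine ⟨{x}, singleton_subset_iff.2 hx, isCompact_singleton, ?_⟩
      rw [Measure.dirac_apply' _ (hA.diff (measurableSet_singleton x))]
      simpa using pos_iff_ne_zero.2 hε
    · refine ⟨∅, empty_subset _, isCompact_empty, ?_⟩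
      rw [sdiff_empty, Measure.dirac_apply' _ hA]
      simpa [hx] using pos_iff_ne_zero.2 hε
  exact ⟨by rw [hvar]; infer_instance, by rw [hvar]; infer_instance⟩

end Regularity

/-! ### Integral strict positivity as a statement about annihilating measures -/

section IntegralStrictPositivity

variable {X H : Type*} [TopologicalSpace X] [T2Space X] [MeasurableSpace X] [BorelSpace X]
  [NormedAddCommGroup H] [InnerProductSpace ℂ H]

theorem pairing_complex_smul (c : ℂ) (u v : H) : pairing H (c • u) v = c • pairing H u v := by
  simp

theorem bartle_mapRange_smul [TopologicalSpace.SeparableSpace H] {η : VectorMeasure X ℂ}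
    (hη : IsRadonBV η) (v : H) (f : X →ᵇ H)
    (φ : ℂ →L[ℝ] H) (hφ : ∀ c, φ c = c • v) :
    bartle (η.mapRange (φ : ℂ →+ H) φ.continuous) f = bartle η fun x => inner ℂ v (f x) := by
  have := hη.finite
  have := (hη.mapRange φ).finite
  refine integral_mapRange η φ (pairing ℂ) (pairing H)
    ((innerSL ℂ v).restrictScalars ℝ) (fun e y => ?_) (stronglyMeasurable_bcf f)
    f.norm_coe_le_norm
  rw [hφ]
  simp

theorem bartle_mapRange_inner {η : VectorMeasure X H} (hη : IsRadonBV η) (a : H) (f : X →ᵇ ℂ) :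
    bartle (η.mapRange ((innerSL ℂ a).restrictScalars ℝ : H →+ ℂ)
      ((innerSL ℂ a).restrictScalars ℝ).continuous) f = bartle η fun x => f x • a := by
  have := hη.finite
  have := (hη.mapRange ((innerSL ℂ a).restrictScalars ℝ)).finite
  refine integral_mapRange η ((innerSL ℂ a).restrictScalars ℝ) (pairing H) (pairing ℂ)
    ((ContinuousLinearMap.toSpanSingleton ℂ a).restrictScalars ℝ) (fun e y => ?_)
    (stronglyMeasurable_bcf f) f.norm_coe_le_norm
  simp

variable [CompleteSpace H] [TopologicalSpace.SeparableSpace H]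

/-- Integration against a vector measure of bounded variation as a functional. -/
def bartleCLM (η : VectorMeasure X H) [IsFiniteMeasure η.variation] : (X →ᵇ H) →L[ℂ] ℂ :=
  integralCLM η (pairing H) pairing_complex_smul

theorem bartleCLM_apply (η : VectorMeasure X H) [IsFiniteMeasure η.variation] (f : X →ᵇ H) :
    bartleCLM η f = bartle η f := rfl

theorem weakIntegral_eq {η : VectorMeasure X H} [IsFiniteMeasure η.variation]
    {T : X → H →L[ℂ] H} {κ : H → X →ᵇ H} (hκ : ∀ v x, κ v x = T x v) {u : H}
    (hu : ∀ v, inner ℂ u v = bartleCLM η (κ v)) : weakIntegral η T = u := by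
  have hT : ∀ v, (fun x => T x v) = κ v := fun v => funext fun x => (hκ v x).symm
  have h : ∃ u, IsWeakIntegral η T u := by
    refine ⟨u, fun v => ⟨?_, ?_⟩⟩
    · rw [hT]
      exact integrable_of_bounded (stronglyMeasurable_bcf (κ v)) ⟨_, (κ v).norm_coe_le_norm⟩
    · rw [hT, hu, bartleCLM_apply]
  rw [weakIntegral, dif_pos h]
  refine ext_inner_right ℂ fun v => ?_
  rw [(h.choose_spec v).2, hu, bartleCLM_apply, hT]

/-- The function `y ↦ ∫ K(x, y) dη(x)` is the representer of integration against `η`. The double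
integral is therefore a squared norm, and it vanishes only if `η` annihilates every section. -/
theorem isIntegrallyStrictlyPosDef_of_dual {K : X → X → H →L[ℂ] H} (hK : IsPosDef K) {C : ℝ}
    (hC : ∀ x y, ‖K x y‖ ≤ C) {κ : X → H → X →ᵇ H} (hκ : ∀ y v x, κ y v x = K x y v)
    (h : ∀ η : VectorMeasure X H, IsRadonBV η →
      (∀ y v, bartle η (κ y v) = 0) → η = 0) : IsIntegrallyStrictlyPosDef K := by
  refine ⟨hK, ⟨C, hC⟩, fun f hf => continuous_of_mem_rkhs hC
    (fun y v => (κ y v).continuous.congr (hκ y v)) hf, fun η hη hne => ?_⟩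
  have := hη.finite
  obtain ⟨f, -, hf, hpos, hzero, -⟩ := exists_representer hK hC hκ (bartleCLM η)
  have hw : (fun y => weakIntegral η fun x => K x y) = f :=
    funext fun y => weakIntegral_eq (hκ y) (hf y)
  rw [hw, ← bartleCLM_apply]
  refine lt_of_le_of_ne hpos fun h0 => hne (h η hη fun y v => ?_)
  rw [← bartleCLM_apply, ← hf, hzero h0.symm]
  simp

theorem IsIntegrallyStrictlyPosDef.eq_zero_of_vanish {K : X → X → H →L[ℂ] H}
    (hK : IsIntegrallyStrictlyPosDef K) {κ : X → H → X →ᵇ H} (hκ : ∀ y v x, κ y v x = K x y v)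
    {η : VectorMeasure X H} (hη : IsRadonBV η) (h : ∀ y v, bartle η (κ y v) = 0) : η = 0 := by
  by_contra hne
  have := hη.finite
  have hw : (fun y => weakIntegral η fun x => K x y) = fun _ => 0 :=
    funext fun y => weakIntegral_eq (hκ y) fun v => by
      rw [inner_zero_left, bartleCLM_apply, h]
  have hlt := hK.pos η hη hne
  rw [hw, bartle, VectorMeasure.integral_zero] at hlt
  exact lt_irrefl _ hlt

end IntegralStrictPositivity

/-! ### Scalar projections and their nonvanishing -/

section Projections

variable {X H : Type*} [NormedAddCommGroup H] [InnerProductSpace ℂ H]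

theorem inner_ofScalar_proj (K : X → X → H →L[ℂ] H) (v : H) (x y : X) (a b : ℂ) :
    inner ℂ a (ofScalar (proj K v) x y b) = inner ℂ (a • v) (K x y (b • v)) := by
  rw [inner_ofScalar, map_smul, inner_smul_left, inner_smul_right, proj]
  simp only [RCLike.star_def]
  ring

theorem IsPosDef.proj {K : X → X → H →L[ℂ] H} (hK : IsPosDef K) (v : H) :
    IsPosDef (ofScalar (proj K v)) := fun s c => by
  simp only [inner_ofScalar_proj]
  exact hK s fun x => c x • v

theorem IsStrictlyPosDef.proj {K : X → X → H →L[ℂ] H} (hK : IsStrictlyPosDef K) {v : H}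
    (hv : v ≠ 0) : IsStrictlyPosDef (ofScalar (proj K v)) := by
  refine ⟨hK.1.proj v, fun s c h x hx => ?_⟩
  simp only [inner_ofScalar_proj] at h
  exact (smul_eq_zero.1 (hK.2 s (fun x => c x • v) h x hx)).resolve_right hv

theorem norm_ofScalar_le {k : X → X → ℂ} {C : ℝ} (hC : ∀ x y, ‖k x y‖ ≤ C) (x y : X) :
    ‖ofScalar k x y‖ ≤ C := by
  rw [ofScalar, norm_smul, ContinuousLinearMap.norm_id, mul_one]
  exact hC x y

theorem norm_proj_le {K : X → X → H →L[ℂ] H} {C : ℝ} (hC : ∀ x y, ‖K x y‖ ≤ C) (v : H)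
    (x y : X) : ‖OperatorKernel.proj K v x y‖ ≤ ‖v‖ * (C * ‖v‖) := by
  grw [OperatorKernel.proj, norm_inner_le_norm, (K x y).le_opNorm, hC]

theorem IsStrictlyPosDef.ofScalar_ne_zero [Nonempty X] {k : X → X → ℂ}
    (hk : IsStrictlyPosDef (ofScalar k)) : k ≠ 0 := by
  rintro rfl
  obtain ⟨x⟩ := ‹Nonempty X›
  exact one_ne_zero (hk.2 {x} (fun _ => 1) (by simp [ofScalar]) x (by simp))

/-- Evaluation at a point annihilates the sections of the zero kernel, yet is a nonzero functional.
-/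
theorem IsUniversal.ofScalar_ne_zero [TopologicalSpace X] [Nonempty X] {k : X → X → ℂ}
    (hk : IsUniversal (ofScalar k)) : k ≠ 0 := by
  rintro rfl
  obtain ⟨x⟩ := ‹Nonempty X›
  have := isCompact_iff_compactSpace.1 (isCompact_singleton (x := x))
  have h := hk.eq_zero_of_vanish (C := 0) (fun x y => by simp [ofScalar]) (κ := fun _ _ => 0)
    (fun y v x => by simp [ofScalar]) (isCompact_singleton (x := x))
    (L := ContinuousMap.evalCLM ℂ ⟨x, rfl⟩) (fun y v => rfl)
  exact one_ne_zero (DFunLike.congr_fun h 1)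

theorem IsIntegrallyStrictlyPosDef.ofScalar_ne_zero [TopologicalSpace X] [T2Space X]
    [MeasurableSpace X] [BorelSpace X] [Nonempty X] {k : X → X → ℂ}
    (hk : IsIntegrallyStrictlyPosDef (ofScalar k)) : k ≠ 0 := by
  rintro rfl
  obtain ⟨x⟩ := ‹Nonempty X›
  have h := hk.eq_zero_of_vanish (κ := fun _ _ => 0) (fun y v x => by simp [ofScalar])
    (isRadonBV_dirac x (1 : ℂ)) fun y v => VectorMeasure.integral_zero
  have h1 := congrArg (fun η : VectorMeasure X ℂ => η univ) h
  simp [VectorMeasure.dirac_apply_of_mem] at h1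

variable [CompleteSpace H] [TopologicalSpace X]

/-- A functional `M` annihilating the sections of `P_v` is lifted to `L = M ∘ ⟨v, ·⟩`. Its
representer `f` is orthogonal to `v` at every point, so `L f = 0`; thus `f = 0`, and universality of
`K` gives `L = 0`. Testing on `g ⊗ v` recovers `M = 0`. -/
theorem IsUniversal.proj {K : X → X → H →L[ℂ] H} (hK : IsUniversal K) {C : ℝ}
    (hC : ∀ x y, ‖K x y‖ ≤ C) {κ : X → H → X →ᵇ H} (hκ : ∀ y v x, κ y v x = K x y v)
    {v : H} (hv : v ≠ 0) : IsUniversal (ofScalar (proj K v)) := by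
  refine isUniversal_of_dual (hK.posDef.proj v) (norm_ofScalar_le (norm_proj_le hC v))
    (κ := fun y c => c • (innerSL ℂ v).compLeftContinuousBounded X (κ y v)) (fun y c x => ?_)
    fun A hA M hM => ?_
  · simp [ofScalar, OperatorKernel.proj, hκ, mul_comm]
  have := isCompact_iff_compactSpace.1 hA
  let L : C(A, H) →L[ℂ] ℂ := M.comp ((innerSL ℂ v).compLeftContinuous ℂ A)
  obtain ⟨f, -, hf, -, hf0, hf1⟩ := exists_representer hK.posDef hC hκ (L.comp (restrictCLM A))
  have hfv : ∀ y, inner ℂ v (f y) = 0 := fun y => by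
    rw [inner_eq_zero_symm, hf]
    have h := hM y 1
    rw [one_smul] at h
    exact h
  have hLf : L.comp (restrictCLM A) f = 0 := by
    have : (innerSL ℂ v).compLeftContinuous ℂ A (restrictCLM A f) = 0 := by
      ext x
      exact hfv x
    rw [ContinuousLinearMap.comp_apply, ContinuousLinearMap.comp_apply, this, map_zero]
  have hL : L = 0 := hK.eq_zero_of_vanish hC hκ hA fun y u => hf1 (hf0 hLf) (κ y u) (by
    have : ⇑(κ y u) = fun x => K x y u := funext (hκ y u)
    rw [this]
    exact section_mem_rkhs hK.posDef y u)
  ext g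
  have h := DFunLike.congr_fun hL (tensorC A g v)
  have e : (innerSL ℂ v).compLeftContinuous ℂ A (tensorC A g v) = (inner ℂ v v : ℂ) • g := by
    ext x
    change inner ℂ v (g x • v) = inner ℂ v v * g x
    rw [inner_smul_right, mul_comm]
  rw [ContinuousLinearMap.comp_apply, e, map_smul] at h
  exact (smul_eq_zero.1 h).resolve_left (inner_self_ne_zero.2 hv)

/-- The same lifting for measures: `η` becomes the vector measure `η v`, whose representer is
pointwise orthogonal to `v`. -/
theorem IsIntegrallyStrictlyPosDef.proj [T2Space X] [MeasurableSpace X] [BorelSpace X]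
    [TopologicalSpace.SeparableSpace H] {K : X → X → H →L[ℂ] H}
    (hK : IsIntegrallyStrictlyPosDef K) {κ : X → H → X →ᵇ H} (hκ : ∀ y v x, κ y v x = K x y v)
    {v : H} (hv : v ≠ 0) : IsIntegrallyStrictlyPosDef (ofScalar (proj K v)) := by
  obtain ⟨C, hC⟩ := hK.bounded
  have hκ' : ∀ y c x, (c • (innerSL ℂ v).compLeftContinuousBounded X (κ y v)) x =
      ofScalar (OperatorKernel.proj K v) x y c := fun y c x => by
    simp [ofScalar, OperatorKernel.proj, hκ, mul_comm]
  refine isIntegrallyStrictlyPosDef_of_dual (hK.posDef.proj v)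
    (norm_ofScalar_le (norm_proj_le hC v)) hκ' fun η hη h0 => ?_
  let φ : ℂ →L[ℝ] H := (ContinuousLinearMap.toSpanSingleton ℂ v).restrictScalars ℝ
  have hφ : ∀ c, φ c = c • v := fun c => rfl
  have hηv := hη.mapRange φ
  have := hηv.finite
  obtain ⟨f, -, hf, -, hf0, hf1⟩ := exists_representer hK.posDef hC hκ (bartleCLM
    (η.mapRange (φ : ℂ →+ H) φ.continuous))
  have hfv : ∀ y, inner ℂ v (f y) = 0 := fun y => by
    rw [inner_eq_zero_symm, hf, bartleCLM_apply, bartle_mapRange_smul hη v _ φ hφ]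
    have h := h0 y 1
    rw [one_smul] at h
    exact h
  have hz : η.mapRange (φ : ℂ →+ H) φ.continuous = 0 := hK.eq_zero_of_vanish hκ hηv fun y u => by
    rw [← bartleCLM_apply]
    refine hf1 (hf0 ?_) (κ y u) ?_
    · rw [bartleCLM_apply, bartle_mapRange_smul hη v _ φ hφ]
      simp only [hfv]
      exact VectorMeasure.integral_zero
    · have : ⇑(κ y u) = fun x => K x y u := funext (hκ y u)
      rw [this]
      exact section_mem_rkhs hK.posDef y u
  ext A hA
  have h : φ (η A) = 0 := congrArg (fun ν : VectorMeasure X H => ν A) hz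
  rw [hφ] at h
  simpa using (smul_eq_zero.1 h).resolve_right hv

end Projections

/-! ### The mixture as a Bochner integral -/

section Mixture

variable {X Ω H : Type*} [TopologicalSpace Ω] [MeasurableSpace Ω] [BorelSpace Ω]
  [TopologicalSpace X]
  [NormedAddCommGroup H] [InnerProductSpace ℂ H] [CompleteSpace H]
  {p : Ω → X → X → ℂ} {C : ℝ}

theorem lsmul_complex_smul (c a : ℂ) (T : H →L[ℂ] H) :
    ContinuousLinearMap.lsmul ℝ ℂ (c • a) T = c • ContinuousLinearMap.lsmul ℝ ℂ a T := by
  simp [mul_smul]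

theorem continuous_mixture
    (hp : Continuous fun q : Ω × X × X => p q.1 q.2.1 q.2.2)
    (hC : ∀ w x y, ‖p w x y‖ ≤ C)
    [T2Space Ω] {Λ : VectorMeasure Ω (H →L[ℂ] H)} (hΛ : IsRadonBV Λ) :
    Continuous fun q : X × X => mixture p Λ q.1 q.2 := by
  have := hΛ.finite
  have := hΛ.regular
  exact (isTight_integralCLM Λ (ContinuousLinearMap.lsmul ℝ ℂ) lsmul_complex_smul).continuous
    (φ := fun q : X × X => sectionΩ hp hC q.1 q.2) (C := max C 0)
    (fun q => (BoundedContinuousFunction.norm_le (le_max_right _ _)).2 fun w =>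
      (hC w q.1 q.2).trans (le_max_left _ _))
    (show Continuous fun q : (X × X) × Ω => p q.2 q.1.1 q.1.2 by fun_prop)

theorem mixture_eq_integral
    (hp : Continuous fun q : Ω × X × X => p q.1 q.2.1 q.2.2)
    (hC : ∀ w x y, ‖p w x y‖ ≤ C)
    {Λ : VectorMeasure Ω (H →L[ℂ] H)} [IsFiniteMeasure Λ.variation]
    {μ : Measure Ω} {G : Ω → H →L[ℂ] H} (hG : Integrable G μ)
    (hΛ : ∀ A, MeasurableSet A → Λ A = ∫ w in A, G w ∂μ) (x y : X) :
    mixture p Λ x y = ∫ w, p w x y • G w ∂μ :=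
  integral_eq_integral_density Λ hG hΛ _ (stronglyMeasurable_bcf (sectionΩ hp hC x y))
    fun w => hC w x y

theorem integrable_smul_density
    (hp : Continuous fun q : Ω × X × X => p q.1 q.2.1 q.2.2)
    (hC : ∀ w x y, ‖p w x y‖ ≤ C)
    {μ : Measure Ω} {E : Type*} [NormedAddCommGroup E]
    [NormedSpace ℂ E] {G : Ω → E} (hG : Integrable G μ)
    (x y : X) : Integrable (fun w => p w x y • G w) μ :=
  hG.bdd_smul (C := C) (stronglyMeasurable_bcf (sectionΩ hp hC x y)).aestronglyMeasurable
    (.of_forall fun w => hC w x y)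

theorem sum_inner_integral
    (hp : Continuous fun q : Ω × X × X => p q.1 q.2.1 q.2.2)
    (hC : ∀ w x y, ‖p w x y‖ ≤ C)
    {μ : Measure Ω} {G : Ω → H →L[ℂ] H} (hG : Integrable G μ)
    (s : Finset X) (v : X → H) :
    Integrable (fun w => ∑ x ∈ s, ∑ y ∈ s, inner ℂ (v x) ((p w x y • G w) (v y))) μ ∧
    ∑ x ∈ s, ∑ y ∈ s, inner ℂ (v x) ((∫ w, p w x y • G w ∂μ) (v y)) =
      ∫ w, ∑ x ∈ s, ∑ y ∈ s, inner ℂ (v x) ((p w x y • G w) (v y)) ∂μ := by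
  let ℓ : X → X → (H →L[ℂ] H) →L[ℂ] ℂ := fun x y =>
    (innerSL ℂ (v x)).comp (ContinuousLinearMap.apply ℂ H (v y))
  have hi : ∀ x y, Integrable (fun w => inner ℂ (v x) ((p w x y • G w) (v y))) μ := fun x y =>
    (ℓ x y).integrable_comp (integrable_smul_density hp hC hG x y)
  have he : ∀ x y, ∫ w, inner ℂ (v x) ((p w x y • G w) (v y)) ∂μ =
      inner ℂ (v x) ((∫ w, p w x y • G w ∂μ) (v y)) := fun x y =>
    (ℓ x y).integral_comp_comm (integrable_smul_density hp hC hG x y)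
  refine ⟨integrable_finsetSum _ fun x _ => integrable_finsetSum _ fun y _ => hi x y, ?_⟩
  rw [integral_finsetSum _ fun x _ => integrable_finsetSum _ fun y _ => hi x y]
  refine Finset.sum_congr rfl fun x _ => ?_
  rw [integral_finsetSum _ fun y _ => hi x y]
  exact Finset.sum_congr rfl fun y _ => (he x y).symm

variable {μ : Measure Ω} {G : Ω → H →L[ℂ] H} {P : X → X → H →L[ℂ] H}

theorem isPosDef_of_density
    (hp : Continuous fun q : Ω × X × X => p q.1 q.2.1 q.2.2)
    (hC : ∀ w x y, ‖p w x y‖ ≤ C)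
    (hpd : ∀ w, IsPosDef (ofScalar (p w))) (hG : Integrable G μ)
    (hGpos : ∀ᵐ w ∂μ, (G w).IsPositive) (hP : ∀ x y, P x y = ∫ w, p w x y • G w ∂μ) :
    IsPosDef P := by
  intro s v
  obtain ⟨hi, he⟩ := sum_inner_integral hp hC hG s v
  simp only [hP, he]
  refine integral_complex_nonneg hi (hGpos.mono fun w hw => ?_)
  exact (hpd w).smul hw s v

end Mixture

/-! ### Positivity of the total mass and the three equivalences -/

section Converse

theorem norm_le_of_density {Ω X H : Type*} [MeasurableSpace Ω]
    [NormedAddCommGroup H] [InnerProductSpace ℂ H] {p : Ω → X → X → ℂ} {C : ℝ}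
    (hC : ∀ w x y, ‖p w x y‖ ≤ C) {μ : Measure Ω} {G : Ω → H →L[ℂ] H} {P : X → X → H →L[ℂ] H}
    (hG : Integrable G μ) (hP : ∀ x y, P x y = ∫ w, p w x y • G w ∂μ) (x y : X) :
    ‖P x y‖ ≤ C * ∫ w, ‖G w‖ ∂μ := by
  rw [hP, ← integral_const_mul]
  refine norm_integral_le_of_norm_le (hG.norm.const_mul C) (.of_forall fun w => ?_)
  rw [norm_smul]
  gcongr
  exact hC w x y

theorem exists_section {X H : Type*} [TopologicalSpace X]
    [NormedAddCommGroup H] [InnerProductSpace ℂ H] {K : X → X → H →L[ℂ] H} {D : ℝ}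
    (hD : ∀ x y, ‖K x y‖ ≤ D) (hK : Continuous fun q : X × X => K q.1 q.2) :
    ∃ κ : X → H → X →ᵇ H, ∀ y v x, κ y v x = K x y v := by
  refine ⟨fun y v => BoundedContinuousFunction.ofNormedAddCommGroup (fun x => K x y v) ?_
    (D * ‖v‖) fun x => ?_, fun y v x => rfl⟩
  · have h : Continuous fun x => K x y := hK.comp (Continuous.prodMk_left y)
    exact h.clm_apply continuous_const
  · grw [(K x y).le_opNorm, hD]

theorem inner_integral_density {Ω H : Type*} [MeasurableSpace Ω] [NormedAddCommGroup H]
    [InnerProductSpace ℂ H] [CompleteSpace H] {μ : Measure Ω} {G : Ω → H →L[ℂ] H}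
    (hG : Integrable G μ) (a b : H) :
    Integrable (fun w => inner ℂ a (G w b)) μ ∧
      ∫ w, inner ℂ a (G w b) ∂μ = inner ℂ a ((∫ w, G w ∂μ) b) := by
  let ℓ : (H →L[ℂ] H) →L[ℂ] ℂ := (innerSL ℂ a).comp (ContinuousLinearMap.apply ℂ H b)
  exact ⟨ℓ.integrable_comp hG, ℓ.integral_comp_comm hG⟩

theorem eq_zero_of_ae_inner_eq_zero {Ω H : Type*} [MeasurableSpace Ω] [NormedAddCommGroup H]
    [InnerProductSpace ℂ H] [CompleteSpace H] {μ : Measure Ω} {G : Ω → H →L[ℂ] H}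
    (hG : Integrable G μ) (hT : IsPosDefOperator (∫ w, G w ∂μ)) {v : H}
    (h : ∀ᵐ w ∂μ, inner ℂ v (G w v) = 0) : v = 0 := by
  by_contra hv
  have hlt := hT v hv
  rw [← (inner_integral_density hG v v).2, integral_congr_ae h, integral_zero] at hlt
  exact lt_irrefl _ hlt

/-- If the nonnegative function `⟨G(w)v, v⟩` has integral zero, it vanishes almost everywhere; it is
a factor of the integrand of `P_v`, so `P_v = 0`. -/
theorem isPosDefOperator_of_proj_ne_zero {Ω X H : Type*} [TopologicalSpace X]
    [TopologicalSpace Ω] [MeasurableSpace Ω] [BorelSpace Ω]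
    [NormedAddCommGroup H] [InnerProductSpace ℂ H] [CompleteSpace H]
    {p : Ω → X → X → ℂ} {C : ℝ} (hp : Continuous fun q : Ω × X × X => p q.1 q.2.1 q.2.2)
    (hC : ∀ w x y, ‖p w x y‖ ≤ C) {μ : Measure Ω} {G : Ω → H →L[ℂ] H} {P : X → X → H →L[ℂ] H}
    (hG : Integrable G μ)
    (hGpos : ∀ᵐ w ∂μ, (G w).IsPositive) (hP : ∀ x y, P x y = ∫ w, p w x y • G w ∂μ)
    (h : ∀ v : H, v ≠ 0 → OperatorKernel.proj P v ≠ 0) : IsPosDefOperator (∫ w, G w ∂μ) := by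
  intro v hv
  obtain ⟨hi, he⟩ := inner_integral_density hG v v
  have hpos : ∀ᵐ w ∂μ, 0 ≤ inner ℂ v (G w v) := hGpos.mono fun w hw => hw.inner_nonneg_right v
  rw [← he]
  refine lt_of_le_of_ne (integral_complex_nonneg hi hpos) fun h0 => h v hv ?_
  have hz := ae_eq_zero_of_integral_complex_eq_zero hi hpos h0.symm
  funext x y
  have hP' := inner_integral_density (integrable_smul_density hp hC hG x y) v v
  rw [OperatorKernel.proj, hP, ← hP'.2]
  refine integral_eq_zero_of_ae (hz.mono fun w hw => ?_)
  change inner ℂ v (p w x y • G w v) = 0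
  rw [inner_smul_right, hw, mul_zero]

variable {X Ω H : Type*} [TopologicalSpace Ω] [MeasurableSpace Ω] [BorelSpace Ω]
  [TopologicalSpace X]
  [NormedAddCommGroup H] [InnerProductSpace ℂ H] [CompleteSpace H]
  {p : Ω → X → X → ℂ} {C : ℝ} {μ : Measure Ω} {G : Ω → H →L[ℂ] H} {P : X → X → H →L[ℂ] H}

theorem isStrictlyPosDef_of_density
    (hp : Continuous fun q : Ω × X × X => p q.1 q.2.1 q.2.2)
    (hC : ∀ w x y, ‖p w x y‖ ≤ C)
    (hpd : ∀ w, IsStrictlyPosDef (ofScalar (p w))) (hG : Integrable G μ)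
    (hGpos : ∀ᵐ w ∂μ, (G w).IsPositive) (hP : ∀ x y, P x y = ∫ w, p w x y • G w ∂μ)
    (hT : IsPosDefOperator (∫ w, G w ∂μ)) : IsStrictlyPosDef P := by
  refine ⟨isPosDef_of_density hp hC (fun w => (hpd w).1) hG hGpos hP, fun s v h0 x hx => ?_⟩
  obtain ⟨hi, he⟩ := sum_inner_integral hp hC hG s v
  simp only [hP, he] at h0
  have hz := ae_eq_zero_of_integral_complex_eq_zero hi
    (hGpos.mono fun w hw => (hpd w).1.smul hw s v) h0
  refine eq_zero_of_ae_inner_eq_zero hG hT ?_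
  filter_upwards [hGpos, hz] with w hw hw0
  exact (hpd w).inner_eq_zero hw hw0 x hx

theorem ofScalar_apply_eq_sectionX {X Ω : Type*} [TopologicalSpace Ω] [TopologicalSpace X]
    {p : Ω → X → X → ℂ} {C : ℝ}
    (hp : Continuous fun q : Ω × X × X => p q.1 q.2.1 q.2.2) (hC : ∀ w x y, ‖p w x y‖ ≤ C)
    (w : Ω) (y : X) (c : ℂ) (x : X) : (c • sectionX hp hC w y) x = ofScalar (p w) x y c := by
  simp [ofScalar, sectionX, mul_comm]

theorem apply_eq_integral (hp : Continuous fun q : Ω × X × X => p q.1 q.2.1 q.2.2)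
    (hC : ∀ w x y, ‖p w x y‖ ≤ C) (hG : Integrable G μ)
    (hP : ∀ x y, P x y = ∫ w, p w x y • G w ∂μ) (x y : X) (v : H) :
    P x y v = ∫ w, p w x y • G w v ∂μ := by
  rw [hP]
  exact ((ContinuousLinearMap.apply ℂ H v).integral_comp_comm
    (integrable_smul_density hp hC hG x y)).symm

theorem isUniversal_of_density [T2Space X]
    (hp : Continuous fun q : Ω × X × X => p q.1 q.2.1 q.2.2)
    (hC : ∀ w x y, ‖p w x y‖ ≤ C) (hC0 : 0 ≤ C)
    (hpd : ∀ w, IsUniversal (ofScalar (p w))) {S : Set Ω} (hS : IsSigmaCompact S)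
    (hμ : μ Sᶜ = 0) (hG : Integrable G μ)
    (hGpos : ∀ᵐ w ∂μ, (G w).IsPositive) (hP : ∀ x y, P x y = ∫ w, p w x y • G w ∂μ)
    {D : ℝ} (hD : ∀ x y, ‖P x y‖ ≤ D) {κ : X → H → X →ᵇ H} (hκ : ∀ y v x, κ y v x = P x y v)
    (hT : IsPosDefOperator (∫ w, G w ∂μ)) : IsUniversal P := by
  refine isUniversal_of_dual (isPosDef_of_density hp hC (fun w => (hpd w).posDef) hG hGpos hP)
    hD hκ fun A hA L hL => ?_
  have := isCompact_iff_compactSpace.1 hA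
  have hae := ae_vanish_of_vanish hp hC hC0 (fun w => (hpd w).posDef) hS hμ hG hGpos
    (fun y v x => (hκ y v x).trans (apply_eq_integral hp hC hG hP x y v))
    (isTight_comp_restrict hA L (T := L.comp (restrictCLM A)) fun f => rfl) hL
  have hae' : ∀ᵐ w ∂μ, ∀ f v, L (tensorC A f (G w v)) = 0 := by
    filter_upwards [hae] with w hw f v
    have h := (hpd w).eq_zero_of_vanish (norm_ofScalar_le (hC w))
      (ofScalar_apply_eq_sectionX hp hC w) hA
      (L := L.comp ((tensorC A).flip (G w v))) fun y c => by
        have e : (c • sectionX hp hC w y).toContinuousMap.restrict A =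
          c • (sectionX hp hC w y).toContinuousMap.restrict A := rfl
        rw [e, map_smul]
        have h0 := hw y v
        have : (L.comp ((tensorC A).flip (G w v)))
          ((sectionX hp hC w y).toContinuousMap.restrict A) = 0 := h0
        rw [this, smul_zero]
    exact DFunLike.congr_fun h f
  refine eq_zero_of_tensor fun f v => ?_
  -- The Riesz vector of `u ↦ L (f ⊗ u)`: inserting `u = G(w) z` gives `⟨z, G(w) z⟩ = 0` for almost
  -- every `w`.
  let z := (InnerProductSpace.toDual ℂ H).symm (L.comp (tensorC A f))
  have hz : ∀ u, inner ℂ z u = L (tensorC A f u) := fun u => InnerProductSpace.toDual_symm_apply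
  have hz0 : z = 0 := eq_zero_of_ae_inner_eq_zero hG hT
    (hae'.mono fun w hw => (hz _).trans (hw f z))
  rw [← hz, hz0, inner_zero_left]

theorem isIntegrallyStrictlyPosDef_of_density [T2Space X] [MeasurableSpace X] [BorelSpace X]
    [TopologicalSpace.SeparableSpace H]
    (hp : Continuous fun q : Ω × X × X => p q.1 q.2.1 q.2.2)
    (hC : ∀ w x y, ‖p w x y‖ ≤ C) (hC0 : 0 ≤ C)
    (hpd : ∀ w, IsIntegrallyStrictlyPosDef (ofScalar (p w))) {S : Set Ω} (hS : IsSigmaCompact S)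
    (hμ : μ Sᶜ = 0) (hG : Integrable G μ)
    (hGpos : ∀ᵐ w ∂μ, (G w).IsPositive) (hP : ∀ x y, P x y = ∫ w, p w x y • G w ∂μ)
    {D : ℝ} (hD : ∀ x y, ‖P x y‖ ≤ D) {κ : X → H → X →ᵇ H} (hκ : ∀ y v x, κ y v x = P x y v)
    (hT : IsPosDefOperator (∫ w, G w ∂μ)) : IsIntegrallyStrictlyPosDef P := by
  refine isIntegrallyStrictlyPosDef_of_dual
    (isPosDef_of_density hp hC (fun w => (hpd w).posDef) hG hGpos hP) hD hκ fun η hη h0 => ?_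
  have := hη.finite
  have := hη.regular
  have hae := ae_vanish_of_vanish hp hC hC0 (fun w => (hpd w).posDef) hS hμ hG hGpos
    (fun y v x => (hκ y v x).trans (apply_eq_integral hp hC hG hP x y v))
    (L := bartleCLM η) (isTight_integralCLM η (pairing H) pairing_complex_smul) h0
  ext A hA
  refine eq_zero_of_ae_inner_eq_zero hG hT ?_
  filter_upwards [hae] with w hw
  -- With this `a`, the scalar measure `⟨a, η⟩` is annihilated by `p_w`, hence zero; its value on
  -- the same set `A` is the form of `G w` at `η A`.
  let a := G w (η A)
  have h : η.mapRange ((innerSL ℂ a).restrictScalars ℝ : H →+ ℂ)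
      ((innerSL ℂ a).restrictScalars ℝ).continuous = 0 :=
    (hpd w).eq_zero_of_vanish (ofScalar_apply_eq_sectionX hp hC w)
      (hη.mapRange ((innerSL ℂ a).restrictScalars ℝ)) fun y c => by
        rw [bartle_mapRange_inner hη a]
        have e : bartle η (fun x => (c • sectionX hp hC w y) x • a) =
          bartleCLM η (tensorCLM X (c • sectionX hp hC w y) a) := rfl
        rw [e, map_smul, _root_.smul_apply, map_smul, hw, smul_zero]
  have h1 : inner ℂ a (η A) = 0 := congrArg (fun ν : VectorMeasure X ℂ => ν A) h
  exact inner_eq_zero_symm.1 h1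

theorem tfae_isStrictlyPosDef [Nonempty X]
    (hp : Continuous fun q : Ω × X × X => p q.1 q.2.1 q.2.2)
    (hC : ∀ w x y, ‖p w x y‖ ≤ C)
    (hpd : ∀ w, IsStrictlyPosDef (ofScalar (p w))) (hG : Integrable G μ)
    (hGpos : ∀ᵐ w ∂μ, (G w).IsPositive) (hP : ∀ x y, P x y = ∫ w, p w x y • G w ∂μ) :
    List.TFAE [IsStrictlyPosDef P, ∀ v : H, v ≠ 0 → IsStrictlyPosDef (ofScalar (proj P v)),
      IsPosDefOperator (∫ w, G w ∂μ)] := by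
  tfae_have 1 → 2 := fun h v hv => h.proj hv
  tfae_have 2 → 3 := fun h =>
    isPosDefOperator_of_proj_ne_zero hp hC hG hGpos hP fun v hv => (h v hv).ofScalar_ne_zero
  tfae_have 3 → 1 :=
    isStrictlyPosDef_of_density hp hC hpd hG hGpos hP
  tfae_finish

theorem tfae_isUniversal [Nonempty X] [T2Space X]
    (hp : Continuous fun q : Ω × X × X => p q.1 q.2.1 q.2.2)
    (hC : ∀ w x y, ‖p w x y‖ ≤ C) (hC0 : 0 ≤ C)
    (hpd : ∀ w, IsUniversal (ofScalar (p w))) {S : Set Ω} (hS : IsSigmaCompact S)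
    (hμ : μ Sᶜ = 0) (hG : Integrable G μ)
    (hGpos : ∀ᵐ w ∂μ, (G w).IsPositive) (hP : ∀ x y, P x y = ∫ w, p w x y • G w ∂μ)
    {D : ℝ} (hD : ∀ x y, ‖P x y‖ ≤ D) {κ : X → H → X →ᵇ H} (hκ : ∀ y v x, κ y v x = P x y v) :
    List.TFAE [IsUniversal P, ∀ v : H, v ≠ 0 → IsUniversal (ofScalar (proj P v)),
      IsPosDefOperator (∫ w, G w ∂μ)] := by
  tfae_have 1 → 2 := fun h v hv => h.proj hD hκ hv
  tfae_have 2 → 3 := fun h =>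
    isPosDefOperator_of_proj_ne_zero hp hC hG hGpos hP fun v hv => (h v hv).ofScalar_ne_zero
  tfae_have 3 → 1 :=
    isUniversal_of_density hp hC hC0 hpd hS hμ hG hGpos hP hD hκ
  tfae_finish

theorem tfae_isIntegrallyStrictlyPosDef [Nonempty X] [T2Space X] [MeasurableSpace X] [BorelSpace X]
    [TopologicalSpace.SeparableSpace H]
    (hp : Continuous fun q : Ω × X × X => p q.1 q.2.1 q.2.2)
    (hC : ∀ w x y, ‖p w x y‖ ≤ C) (hC0 : 0 ≤ C)
    (hpd : ∀ w, IsIntegrallyStrictlyPosDef (ofScalar (p w))) {S : Set Ω} (hS : IsSigmaCompact S)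
    (hμ : μ Sᶜ = 0) (hG : Integrable G μ)
    (hGpos : ∀ᵐ w ∂μ, (G w).IsPositive) (hP : ∀ x y, P x y = ∫ w, p w x y • G w ∂μ)
    {D : ℝ} (hD : ∀ x y, ‖P x y‖ ≤ D) {κ : X → H → X →ᵇ H} (hκ : ∀ y v x, κ y v x = P x y v) :
    List.TFAE [IsIntegrallyStrictlyPosDef P,
      ∀ v : H, v ≠ 0 → IsIntegrallyStrictlyPosDef (ofScalar (proj P v)),
      IsPosDefOperator (∫ w, G w ∂μ)] := by
  tfae_have 1 → 2 := fun h v hv => h.proj hκ hv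
  tfae_have 2 → 3 := fun h =>
    isPosDefOperator_of_proj_ne_zero hp hC hG hGpos hP fun v hv => (h v hv).ofScalar_ne_zero
  tfae_have 3 → 1 :=
    isIntegrallyStrictlyPosDef_of_density hp hC hC0 hpd hS hμ hG hGpos hP hD hκ
  tfae_finish

end Converse

end OperatorKernel

end

/-! ### The main theorem -/

theorem mainTheorem2 {X Ω H : Type*}
    [TopologicalSpace X] [T2Space X] [Nonempty X] [MeasurableSpace X] [BorelSpace X]
    [TopologicalSpace Ω] [T2Space Ω] [LocallyCompactSpace Ω] [MeasurableSpace Ω] [BorelSpace Ω]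
    [NormedAddCommGroup H] [InnerProductSpace ℂ H] [CompleteSpace H]
    [TopologicalSpace.SeparableSpace H]
    (p : Ω → X → X → ℂ)
    (hp_cont : Continuous fun q : Ω × X × X => p q.1 q.2.1 q.2.2)
    (hp_bdd : ∃ C : ℝ, ∀ w x y, ‖p w x y‖ ≤ C)
    (hp_pd : ∀ w, OperatorKernel.IsPosDef (OperatorKernel.ofScalar (p w)))
    (Λ : VectorMeasure Ω (H →L[ℂ] H))
    (hΛ_nonneg : ∀ A, MeasurableSet A → (Λ A).IsPositive)
    (hΛ_radon : OperatorKernel.IsRadonBV Λ)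
    (hΛ_rn : OperatorKernel.HasRadonNikodym Λ)
    (P : X → X → H →L[ℂ] H) (hP : P = OperatorKernel.mixture p Λ) :
    -- well definedness and positive definiteness
    ((∀ x y, Λ.Integrable fun w => p w x y) ∧
      OperatorKernel.IsPosDef P ∧
      ∀ v : H, v ≠ 0 →
        OperatorKernel.IsPosDef (OperatorKernel.ofScalar (OperatorKernel.proj P v))) ∧
    -- boundedness and norm continuity
    ((∃ C : ℝ, ∀ x y, ‖P x y‖ ≤ C) ∧
      (Continuous fun q : X × X => P q.1 q.2) ∧
      ∀ f ∈ OperatorKernel.rkhs P, Continuous f) ∧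
    -- strict positive definiteness
    ((∀ w, OperatorKernel.IsStrictlyPosDef (OperatorKernel.ofScalar (p w))) →
      List.TFAE [
        OperatorKernel.IsStrictlyPosDef P,
        ∀ v : H, v ≠ 0 →
          OperatorKernel.IsStrictlyPosDef (OperatorKernel.ofScalar (OperatorKernel.proj P v)),
        OperatorKernel.IsPosDefOperator (Λ Set.univ)]) ∧
    -- universality
    ((∀ w, OperatorKernel.IsUniversal (OperatorKernel.ofScalar (p w))) →
      List.TFAE [
        OperatorKernel.IsUniversal P,
        ∀ v : H, v ≠ 0 →
          OperatorKernel.IsUniversal (OperatorKernel.ofScalar (OperatorKernel.proj P v)),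
        OperatorKernel.IsPosDefOperator (Λ Set.univ)]) ∧
    -- integral strict positive definiteness
    (LocallyCompactSpace X →
      (∀ w, OperatorKernel.IsIntegrallyStrictlyPosDef (OperatorKernel.ofScalar (p w))) →
      List.TFAE [
        OperatorKernel.IsIntegrallyStrictlyPosDef P,
        ∀ v : H, v ≠ 0 → OperatorKernel.IsIntegrallyStrictlyPosDef
          (OperatorKernel.ofScalar (OperatorKernel.proj P v)),
        OperatorKernel.IsPosDefOperator (Λ Set.univ)]) := by
  obtain ⟨C', hC'⟩ := hp_bdd
  -- The maximum with zero is needed because `Ω` may be empty, when the given bound could be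
  -- negative.
  obtain ⟨C, hC, hC0⟩ : ∃ C : ℝ, (∀ w x y, ‖p w x y‖ ≤ C) ∧ 0 ≤ C :=
    ⟨max C' 0, fun w x y => (hC' w x y).trans (le_max_left _ _), le_max_right _ _⟩
  have := hΛ_radon.finite
  obtain ⟨μ, G, S, hS, hμ, hG, hGpos, hΛ⟩ :=
    OperatorKernel.exists_density hΛ_nonneg hΛ_radon hΛ_rn
  have hT : Λ Set.univ = ∫ w, G w ∂μ := by rw [hΛ _ .univ, setIntegral_univ]
  have hcont : Continuous fun q : X × X => P q.1 q.2 := by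
    rw [hP]
    exact OperatorKernel.continuous_mixture hp_cont hC hΛ_radon
  have hint : ∀ x y, Λ.Integrable fun w => p w x y := fun x y =>
    OperatorKernel.integrable_of_bounded (OperatorKernel.stronglyMeasurable_bcf
      (OperatorKernel.sectionΩ hp_cont hC x y)) ⟨C, fun w => hC w x y⟩
  replace hP : ∀ x y, P x y = ∫ w, p w x y • G w ∂μ := by
    rw [hP]
    exact OperatorKernel.mixture_eq_integral hp_cont hC hG hΛ
  have hD := OperatorKernel.norm_le_of_density hC hG hP
  obtain ⟨κ, hκ⟩ := OperatorKernel.exists_section hD hcont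
  have hpd := OperatorKernel.isPosDef_of_density hp_cont hC hp_pd hG hGpos hP
  rw [hT]
  exact ⟨⟨hint, hpd, fun v _ => hpd.proj v⟩,
    ⟨⟨_, hD⟩, hcont, fun f hf => OperatorKernel.continuous_of_mem_rkhs hD
      (fun y v => (κ y v).continuous.congr (hκ y v)) hf⟩,
    fun h => OperatorKernel.tfae_isStrictlyPosDef hp_cont hC h hG hGpos hP,
    fun h => OperatorKernel.tfae_isUniversal hp_cont hC hC0 h hS hμ hG hGpos hP hD hκ,
    fun _ h =>
      OperatorKernel.tfae_isIntegrallyStrictlyPosDef hp_cont hC hC0 h hS hμ hG hGpos hP hD hκ⟩
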